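/- Consider a 3D color code on a finite lattice that is a 4-valent, 4-colored cellulation of a closed 3-manifold. The cells carry colors from a set $\mathbf C$ of four colors so that adjacent cells have different colors. An edge has the color of the cells that it connects, so each vertex has one edge of each color. There is one qubit on each vertex, one $X$-stabilizer $\prod_{v\in c}X(v)$ for each cell $c$, and one $Z$-stabilizer $\prod_{v\in f}Z(v)$ for each face $f$. Let $\mathbf C=\{\mathbf c_1,\mathbf c_2,\mathbf c_3,\mathbf c_4\}$, and cut the lattice along a surface that intersects only edges of color $\mathbf c_4$. Let $R$ be the set of vertices on the retained side. The $Z$-boundary code has the qubits in $R$. Its stabilizers are the $X$-stabilizers of the cells contained in $R$ (those of cells that the surface meets are removed) and the operators $\prod_{v\in f\cap R}Z(v)$ for all faces $f$ with $f\cap R\neq\emptyset$ (those of faces that the surface meets are truncated). Bulk excitations are as follows. The charges $(\mathbf c)_{\mathbf z}$, $\mathbf c\in\mathbf C$, are violated $X$-stabilizers of $\mathbf c$-colored cells; each has order two and the product of all four is trivial. The fluxes $(\mathbf c\mathbf c')_{\mathbf x}$, $\mathbf c\ne\mathbf c'$, are carried by violated $Z$-stabilizers on faces between $\mathbf c$-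 and $\mathbf c'$-colored cells, and are identified by their mutual statistics with the charges: $-1$ with the charges of the two colors other than $\mathbf c,\mathbf c'$, and trivial with $(\mathbf c)_{\mathbf z}$ and $(\mathbf c')_{\mathbf z}$. Let $E$ be a set of cut edges (a patch of the boundary). A pair of a charge $q$ and a flux $\varphi$ condenses on $E$ if there is a Pauli operator $P$ on $R$ that - commutes with all truncated stabilizers of the code; - violates bulk $X$-stabilizers of total charge $q$; - creates a flux configuration on the bulk faces whose total flux running into the cells that are cut by the surface and contain an edge of $E$ is $\varphi$; and - absorbs no charge elsewhere on the boundary: $P$ commutes with $\prod_{v\in c\cap R}X(v)$ for all other cells $c$ that the surface cuts. Then the following hold. 1. Let $E$ be any patch of the boundary that is adjacent to a bulk: for every $i\in\{1,2,3\}$, some edge of $E$ is connected, by a path of edges in $R$ from its retained end, to a $\mathbf c_i$-colored cell contained in $R$. Then the set of excitations that condense on $E$ is exactly the group generated by $(\mathbf c_1)_{\mathbf z},(\mathbf c_2)_{\mathbf z},(\mathbf c_3)_{\mathbf z}$. In particular, no excitation with a nontrivial flux condenses. 2. The $Z$-boundary code is equivalent, up to local unitaries and adding or removing ancilla qubits,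 to the $(e_1,e_2,e_3)$ (all-rough) boundary of three copies of the 3D toric code. Precisely, for $i=1,2,3$ let $\mathcal L_i$ be the lattice obtained by shrinking the $\mathbf c_i$-colored cells to points. Its vertices are the $\mathbf c_i$-colored cells, its edges are the $\mathbf c_i$-colored edges, and its faces are the faces of the original lattice whose edges have color $\mathbf c_i$ and one other color. The $i$-th copy is the toric code with rough boundary on $\mathcal L_i$: there is one qubit on each $\mathbf c_i$-colored edge in $R$, a vertex $X$-stabilizer for each vertex all of whose edges are retained, and a $Z$-stabilizer for each face, truncated to the retained edges. Then, after adding ancilla qubits in product states, there is a unitary $U=\bigotimes_c U_c$, where $c$ runs over the $\mathbf c_4$-colored cells and $U_c$ acts only on qubits and ancillas located on $c$, that conjugates the stabilizer group of the $Z$-boundary code (with ancillas) onto that of the tensor product of the three rough toric codes (with ancillas). -/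

import Mathlib

open scoped Classical

noncomputable section

/-! ## Qubits, Pauli operators, CSS stabilizer codes -/

/-- Operators on the Hilbert space of the qubits in `Q`; the computational basis is `Q → ZMod 2`. -/
abbrev QOp (Q : Type*) := Matrix (Q → ZMod 2) (Q → ZMod 2) ℂ

/-- The product of the Pauli operators `X` on the qubits in `A`. -/
def xOp {Q : Type*} (A : Set Q) : QOp Q :=
  fun t s => if t = s + A.indicator 1 then 1 else 0

/-- The product of the Pauli operators `Z` on the qubits in `A`. -/
def zOp {Q : Type*} (A : Set Q) : QOp Q :=
  Matrix.diagonal fun s => (-1) ^ {q ∈ A | s q = 1}.ncard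

/-- A CSS stabilizer code, given by the supports of its `X`- and `Z`-type generators. -/
structure CSSCode (Q : Type*) where
  xs : Set (Set Q)
  zs : Set (Set Q)

namespace CSSCode

/-- The stabilizer group. (The generators square to one, so the monoid they generate is a group.) -/
def stabilizer {Q : Type*} [Fintype Q] (C : CSSCode Q) : Submonoid (QOp Q) :=
  Submonoid.closure (xOp '' C.xs ∪ zOp '' C.zs)

/-- Add ancilla qubits, labelled by `A`, in the product state with stabilizers `Z(a)`. -/
def withAncillas {Q : Type*} (C : CSSCode Q) (A : Type*) : CSSCode (Q ⊕ A) where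
  xs := (fun s => Sum.inl '' s) '' C.xs
  zs := (fun s => Sum.inl '' s) '' C.zs ∪ Set.range fun a : A => {Sum.inr a}

/-- The tensor product of a family of codes. -/
def tensor {ι : Type*} {Q : ι → Type*} (C : ∀ i, CSSCode (Q i)) : CSSCode (Σ i, Q i) where
  xs := {s | ∃ i, ∃ t ∈ (C i).xs, s = Sigma.mk i '' t}
  zs := {s | ∃ i, ∃ t ∈ (C i).zs, s = Sigma.mk i '' t}

end CSSCode

/-- The tensor product over all blocks `b` of the operators `u b`, where `u b` takes the qubits of
`Q` that lie in block `b` to the qubits of `Q'` that lie in block `b`. -/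
def tensorBlocks {Q Q' B : Type*} [Fintype B] (block : Q → B) (block' : Q' → B)
    (u : ∀ b, Matrix ({q // block' q = b} → ZMod 2) ({q // block q = b} → ZMod 2) ℂ) :
    Matrix (Q' → ZMod 2) (Q → ZMod 2) ℂ :=
  fun t s => ∏ b, u b (fun q => t q.1) (fun q => s q.1)

/-- Equivalence of two stabilizer codes up to local unitaries and ancilla qubits. Every qubit
belongs to a block (a bounded piece of the lattice); after adding `n b` ancillas to the first and
`n' b` ancillas to the second code in each block `b`, a unitary `⨂ u b`, where `u b` acts
within the block `b` only, conjugates the first stabilizer group onto the second. -/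
def LocallyEquivalent {Q Q' B : Type*} [Fintype Q] [Fintype Q'] [Fintype B]
    (block : Q → B) (block' : Q' → B) (C : CSSCode Q) (C' : CSSCode Q') : Prop :=
  ∃ (n n' : B → ℕ)
    (u : ∀ b, Matrix
      ({q : Q' ⊕ (Σ b, Fin (n' b)) // Sum.elim block' Sigma.fst q = b} → ZMod 2)
      ({q : Q ⊕ (Σ b, Fin (n b)) // Sum.elim block Sigma.fst q = b} → ZMod 2) ℂ),
    (∀ b, (u b).conjTranspose * u b = 1 ∧ u b * (u b).conjTranspose = 1) ∧
    (fun S => tensorBlocks _ _ u * S * (tensorBlocks _ _ u).conjTranspose) ''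
        ((C.withAncillas (Σ b, Fin (n b))).stabilizer : Set (QOp (Q ⊕ (Σ b, Fin (n b))))) =
      (C'.withAncillas (Σ b, Fin (n' b))).stabilizer

/-! ## The lattice of the 3D color code -/

/-- The four colors. -/
abbrev Color := Fin 4

/-- The vertices and edges of a 4-valent lattice whose edges carry four colors, one edge of each
color at each vertex: the edge of color `a` at `v` joins `v` and `σ a v`. -/
structure ColorGraph (V : Type*) where
  σ : Color → Equiv.Perm V
  σ_σ : ∀ a v, σ a (σ a v) = v
  σ_ne : ∀ a v, σ a v ≠ v

namespace ColorGraph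

variable {V : Type*}

/-- The vertices that can be reached from `v` along edges with colors in `S`. -/
def comp (L : ColorGraph V) (S : Set Color) (v : V) : Set V :=
  MulAction.orbit (Subgroup.closure (L.σ '' S)) v

/-- The edges of color `a`, as sets of two vertices. -/
def edges (L : ColorGraph V) (a : Color) : Set (Set V) := Set.range (L.comp {a})

/-- The faces between cells of colors `a` and `b`, as sets of vertices: the cycles formed by edges
of the two other colors. -/
def faces (L : ColorGraph V) (a b : Color) : Set (Set V) := Set.range (L.comp {a, b}ᶜ)

/-- The cells of color `a`, as sets of vertices. Their edges have the three other colors, and the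
edges of color `a` are those that connect cells of color `a`. -/
def cells (L : ColorGraph V) (a : Color) : Set (Set V) := Set.range (L.comp {a}ᶜ)

/-- The lattice is a cellulation of a closed 3-manifold: the boundary of every cell, a closed
surface that the cell's edges divide into the cell's faces, is a sphere (Euler characteristic 2). -/
def IsCellulation (L : ColorGraph V) : Prop :=
  ∀ a, ∀ c ∈ L.cells a,
    (c.ncard : ℤ) - ∑ b ∈ Finset.univ.erase a, ({e ∈ L.edges b | e ⊆ c}.ncard : ℤ)
      + ∑ b ∈ Finset.univ.erase a, ({f ∈ L.faces a b | f ⊆ c}.ncard : ℤ) = 2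

/-- `R` is the set of vertices on the retained side of a surface that intersects only edges of
color `c₄`: an edge with one end on each side has color `c₄`. -/
def IsCut (L : ColorGraph V) (c₄ : Color) (R : Set V) : Prop :=
  ∀ a v, v ∈ R → L.σ a v ∉ R → a = c₄

/-- The surface that bounds `R` passes through the face or cell `s`. -/
def IsTruncated (R s : Set V) : Prop := (s ∩ R).Nonempty ∧ ¬ s ⊆ R

/-- The color code on the qubits `R`: an `X`-stabilizer for each cell and a `Z`-stabilizer for each
face inside `R`. For cells (faces) through which the surface passes, the stabilizer is
truncated to the qubits in `R` if `keepX` (`keepZ`), and is removed otherwise. -/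
def cutCode (L : ColorGraph V) (R : Set V) (keepX keepZ : Prop) : CSSCode R where
  xs := {s | ∃ a, ∃ c ∈ L.cells a, (c ⊆ R ∨ IsTruncated R c ∧ keepX) ∧ s = Subtype.val ⁻¹' c}
  zs := {s | ∃ a b, a ≠ b ∧ ∃ f ∈ L.faces a b,
    (f ⊆ R ∨ IsTruncated R f ∧ keepZ) ∧ s = Subtype.val ⁻¹' f}

/-- The color code with `Z`-boundary: `X`-stabilizers that meet the surface are removed,
`Z`-stabilizers that meet the surface are truncated. -/
def zBoundaryCode (L : ColorGraph V) (R : Set V) : CSSCode R := L.cutCode R False True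

end ColorGraph

/-! ## Excitations and condensation -/

/-- Electric charges: generated by one charge of order two for each color, the product of the four
being trivial. -/
abbrev Charge := (Color → ZMod 2) ⧸ Submodule.span (ZMod 2) {(1 : Color → ZMod 2)}

/-- The charge `(a)_z`, a violated `X`-stabilizer on a cell of color `a`. -/
def zCharge (a : Color) : Charge := Submodule.Quotient.mk (Pi.single a 1)

/-- The flux `(ab)_x`, carried by violated `Z`-stabilizers on faces between cells of colors `a` and
`b`. A flux is recorded by its mutual statistics with the four charges: `(ab)_x` has
statistics `-1` with the charges of the two other colors, and trivial statistics with
`(a)_z` and `(b)_z`. -/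
def xFlux (a b : Color) : Color → ZMod 2 := fun d => if d = a ∨ d = b then 0 else 1

/-- The group of fluxes. -/
abbrev Flux := AddSubgroup.closure {φ : Color → ZMod 2 | ∃ a b, a ≠ b ∧ φ = xFlux a b}

/-- The topological excitations of the bulk: charges, fluxes and their composites. -/
abbrev Excitation := Charge × Flux

/-- The operator `P` creates an excitation of the stabilizer `S`: the two anticommute. -/
def Violates {Q : Type*} [Fintype Q] (P S : QOp Q) : Prop := P * S = -(S * P)

namespace ColorGraph

variable {V : Type*}

/-- The cells of color `a` through which the surface passes at one of the cut edges in `E`. -/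
def patchCells (L : ColorGraph V) (R E : Set V) (a : Color) : Set (Set V) :=
  {c ∈ L.cells a | IsTruncated R c ∧ (c ∩ E).Nonempty}

/-- The total charge of the violated `X`-stabilizers in the bulk. -/
def bulkCharge [Fintype V] (L : ColorGraph V) (R : Set V) (P : QOp R) : Charge :=
  ∑ a, {c ∈ L.cells a | c ⊆ R ∧ Violates P (xOp (Subtype.val ⁻¹' c))}.ncard • zCharge a

/-- The total flux that runs from the bulk into the cells of the patch `E` of the boundary: each
violated bulk face between an `a`- and a `b`-cell carries the flux `(ab)_x` from one to the other. -/
def fluxInto [Fintype V] (L : ColorGraph V) (R E : Set V) (P : QOp R) : Color → ZMod 2 :=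
  ∑ a, ∑ b ∈ Finset.univ.erase a,
    {f ∈ L.faces a b | f ⊆ R ∧ Violates P (zOp (Subtype.val ⁻¹' f)) ∧
      ∃ c ∈ L.patchCells R E a, f ⊆ c}.ncard • xFlux a b

/-- The excitation `x` condenses on the patch `E` of the boundary of `L.cutCode R keepX keepZ`: some
Pauli operator `P` (a product of strings and membranes) ends on `E`, where it absorbs flux `x.2`,
creates charge `x.1` in the bulk, and creates no excitation on the boundary, that is,
commutes with all truncated stabilizers of the code. Moreover no charge is absorbed on the
boundary away from `E`, that is, `P` commutes with the truncation of `X(c)` for any other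
truncated cell `c`. -/
def Condenses [Fintype V] (L : ColorGraph V) (R : Set V) (keepX keepZ : Prop) (E : Set V)
    (x : Excitation) : Prop :=
  ∃ A B : Set R,
    (∀ a, ∀ c ∈ L.cells a, IsTruncated R c → (keepX ∨ c ∉ L.patchCells R E a) →
      Commute (xOp A * zOp B) (xOp (Subtype.val ⁻¹' c))) ∧
    (∀ a b, a ≠ b → ∀ f ∈ L.faces a b, IsTruncated R f → keepZ →
      Commute (xOp A * zOp B) (zOp (Subtype.val ⁻¹' f))) ∧
    L.bulkCharge R (xOp A * zOp B) = x.1 ∧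
    L.fluxInto R E (xOp A * zOp B) = x.2

/-- The patch `E` of the boundary is adjacent to a bulk: for every color `a ≠ c₄`, it is connected
through `R` to some cell of color `a` that is entirely retained. -/
def AdjacentToBulk (L : ColorGraph V) (c₄ : Color) (R E : Set V) : Prop :=
  ∀ a, a ≠ c₄ → ∃ v ∈ E, ∃ w, L.comp {a}ᶜ w ⊆ R ∧
    Relation.ReflTransGen (fun u u' => u' ∈ R ∧ ∃ b, u' = L.σ b u) v w

end ColorGraph

/-! ## The 3D toric code -/

/-- The data of a lattice that enter the toric code: `inc v e` is the number of ends of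
the edge `e` at the vertex `v`, and `bd f` is the set of edges around the face `f`. -/
structure ToricLattice.{u} where
  Vert : Type u
  Edge : Type u
  Face : Type u
  inc : Vert → Edge → ℕ
  bd : Face → Set Edge

/-- The toric code (one qubit per edge, `X`-stabilizers at vertices, `Z`-stabilizers at faces) with
rough boundary, where only the edges in `K` are retained: the `X`-stabilizer of a vertex that
has lost an edge is removed, so that its remaining edges dangle, and the `Z`-stabilizers of faces
that have lost edges are truncated. (An edge with both ends at `v` drops out of the
`X`-stabilizer at `v`.) -/
def ToricLattice.roughCode (T : ToricLattice) (K : Set T.Edge) : CSSCode K where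
  xs := {s | ∃ v, (∀ e, T.inc v e ≠ 0 → e ∈ K) ∧ s = {e | Odd (T.inc v e.1)}}
  zs := {s | ∃ f, (T.bd f ∩ K).Nonempty ∧ s = {e | e.1 ∈ T.bd f}}

namespace ColorGraph

variable {V : Type*}

/-- The lattice obtained by shrinking the cells of color `a` to points: its vertices are the cells of
color `a`, its edges are the edges of color `a`, and its faces are the faces that do not
belong to a cell of color `a`, i.e. those formed by edges of color `a` and one more color. -/
def shrink (L : ColorGraph V) (a : Color) : ToricLattice where
  Vert := L.cells a
  Edge := L.edges a
  Face := {p : Color × Set V // p.1 ≠ a ∧ p.2 ∈ Set.range (L.comp {a, p.1})}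
  inc c e := (c.1 ∩ e.1).ncard
  bd p := {e | e.1 ⊆ p.1.2}

/-- The edges of color `a` on the retained side. -/
def retained (L : ColorGraph V) (R : Set V) (a : Color) : Set (L.edges a) := {e | e.1 ⊆ R}

/-- The toric code with rough boundary on the lattice obtained by shrinking the cells of
color `a`. -/
def roughToric (L : ColorGraph V) (R : Set V) (a : Color) : CSSCode (L.retained R a) :=
  (L.shrink a).roughCode (L.retained R a)

/-- The cell of color `a` around `s` (a vertex, or an edge of another color). -/
def cellAround (L : ColorGraph V) (a : Color) (s : Set V) : Set V := ⋃ v ∈ s, L.comp {a}ᶜ v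

end ColorGraph

end

/-! Both codes are CSS, so both claims reduce to linear algebra over `ZMod 2` on supports. Write d
for the color c₄.

Equivalence. The cut meets only d-edges, so a d-cell that touches `R` lies in `R`. On such a cell,
trade the vertex bits x for the sums x u + x v along its edges together with x at one reference
vertex (`unfoldMap`). The cell is connected, so this is injective, and it acts within d-cells. The
`X`-stabilizer of a d-cell is invisible on edges and flips only the reference bit; a Hadamard there
makes it an ancilla stabilizer `Z`. The `X`-stabilizer of a cell of another color a flips just the
a-edges with one end in it, which is the vertex stabilizer of the a-th toric code. A face with an
edge color a ≠ d is perfectly matched by its a-edges, so its `Z`-parity is the parity of the edge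
sums on them, which is a toric face stabilizer.

Edge sums are not independent: ancillas on the color code side make up the difference in dimension,
and the map extends to an isomorphism in each block (`exists_local_extension`). For the groups to
match, every `Z`-string that vanishes on all vectors of edge sums must be a toric stabilizer. On
each d-cell such a string is a cycle. The cell boundary is a sphere, so the cycle is a sum of face
boundaries (`exists_faceBoundary_eq`), and the edges of either color around a face form a stabilizer
of the toric code of that color. This is the only use of the Euler characteristic.

Condensation. The (a,b)-faces tile each a-cell for every b ≠ a, and truncated faces are not
violated. So the parity of violated (a,b)-faces on an a-cell is the same for the three b, and the
three fluxes (ab)_x sum to zero: no flux is absorbed (`fluxInto_eq_zero`). Conversely a `Z`-string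
from the patch to a retained a-cell creates the charge of color a (`exists_string`). As all four
charges sum to zero, the three colors other than d generate every charge. -/

noncomputable section

/-! ## Pauli operators labelled by vectors over `ZMod 2` -/

/-- The sign `(-1) ^ a`. -/
def zmodSign (a : ZMod 2) : ℂ := if a = 1 then -1 else 1

theorem zmod_two_cases (a : ZMod 2) : a = 0 ∨ a = 1 := by
  revert a; decide

theorem zmodSign_zero : zmodSign 0 = 1 := by simp [zmodSign]

theorem zmodSign_one : zmodSign 1 = -1 := by simp [zmodSign]

theorem zmodSign_add (a b : ZMod 2) : zmodSign (a + b) = zmodSign a * zmodSign b := by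
  rcases zmod_two_cases a with rfl | rfl <;> rcases zmod_two_cases b with rfl | rfl <;>
    simp [zmodSign, show (1 : ZMod 2) + 1 = 0 from rfl]

theorem zmodSign_mul_self (a : ZMod 2) : zmodSign a * zmodSign a = 1 := by
  rw [← zmodSign_add, CharTwo.add_self_eq_zero, zmodSign_zero]

theorem star_zmodSign (a : ZMod 2) : star (zmodSign a) = zmodSign a := by
  rcases zmod_two_cases a with rfl | rfl <;> simp [zmodSign]

theorem zmodSign_sum {ι : Type*} (s : Finset ι) (f : ι → ZMod 2) :
    zmodSign (∑ i ∈ s, f i) = ∏ i ∈ s, zmodSign (f i) := by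
  induction s using Finset.induction_on with
  | empty => simp [zmodSign_zero]
  | insert a s ha ih => rw [Finset.sum_insert ha, Finset.prod_insert ha, zmodSign_add, ih]

theorem zmodSign_natCast (n : ℕ) : zmodSign (n : ZMod 2) = (-1) ^ n := by
  induction n with
  | zero => simp [zmodSign_zero]
  | succ n ih => rw [Nat.cast_succ, zmodSign_add, ih, zmodSign_one, pow_succ]

section Pauli

variable {Q : Type*}

/-- The `X`-type Pauli operator with support vector `a`. -/
def pauliX (a : Q → ZMod 2) : QOp Q := fun t s => if t = s + a then 1 else 0

/-- The `Z`-type Pauli operator with support vector `b`. -/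
def pauliZ [Fintype Q] (b : Q → ZMod 2) : QOp Q := Matrix.diagonal fun s => zmodSign (b ⬝ᵥ s)

theorem xOp_eq_pauliX (A : Set Q) : xOp A = pauliX (A.indicator 1) := rfl

theorem indicator_dotProduct [Fintype Q] (A : Set Q) (s : Q → ZMod 2) :
    A.indicator 1 ⬝ᵥ s = ({q ∈ A | s q = 1}.ncard : ZMod 2) := by
  rw [Set.ncard_eq_toFinset_card', dotProduct, Finset.card_eq_sum_ones, Nat.cast_sum,
    ← Finset.sum_filter_add_sum_filter_not Finset.univ (fun q => q ∈ A ∧ s q = 1)]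
  rw [Finset.sum_eq_zero (s := Finset.univ.filter fun q => ¬ (q ∈ A ∧ s q = 1)), add_zero]
  · refine Finset.sum_congr (by ext; simp) fun q hq => ?_
    have h := Set.mem_toFinset.1 hq
    simp [h.1, h.2]
  · intro q hq
    have h := (Finset.mem_filter.1 hq).2
    by_cases hA : q ∈ A
    · rcases zmod_two_cases (s q) with h' | h'
      · simp [h']
      · exact absurd ⟨hA, h'⟩ h
    · simp [hA]

theorem zOp_eq_pauliZ [Fintype Q] (A : Set Q) : zOp A = pauliZ (A.indicator 1) := by
  ext t s
  simp only [zOp, pauliZ, Matrix.diagonal_apply, indicator_dotProduct, zmodSign_natCast]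
  congr

theorem function_add_self (a : Q → ZMod 2) : a + a = 0 :=
  funext fun _ => CharTwo.add_self_eq_zero _

variable [Fintype Q]

theorem pauliX_zero [DecidableEq Q] : pauliX (0 : Q → ZMod 2) = 1 := by
  ext t s
  simp [pauliX, Matrix.one_apply]

theorem pauliZ_zero [DecidableEq Q] : pauliZ (0 : Q → ZMod 2) = 1 := by
  simp [pauliZ, zmodSign_zero]

variable [DecidableEq Q]

theorem mul_pauliX_apply {T : Type*} (K : Matrix T (Q → ZMod 2) ℂ) (a : Q → ZMod 2) (t s) :
    (K * pauliX a) t s = K t (s + a) := by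
  simp [Matrix.mul_apply, pauliX]

theorem pauliX_mul_apply {T : Type*} (K : Matrix (Q → ZMod 2) T ℂ) (a : Q → ZMod 2) (t s) :
    (pauliX a * K) t s = K (t + a) s := by
  rw [Matrix.mul_apply, Finset.sum_eq_single (t + a)]
  · simp [pauliX, add_assoc, function_add_self]
  · intro b _ hb
    have : t ≠ b + a := fun h => hb (by rw [h, add_assoc, function_add_self, add_zero])
    simp [pauliX, this]
  · simp

theorem mul_pauliZ_apply {T : Type*} (K : Matrix T (Q → ZMod 2) ℂ) (b : Q → ZMod 2) (t s) :
    (K * pauliZ b) t s = K t s * zmodSign (b ⬝ᵥ s) := by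
  rw [pauliZ, Matrix.mul_diagonal]

theorem pauliZ_mul_apply {T : Type*} (K : Matrix (Q → ZMod 2) T ℂ) (b : Q → ZMod 2) (t s) :
    (pauliZ b * K) t s = zmodSign (b ⬝ᵥ t) * K t s := by
  rw [pauliZ, Matrix.diagonal_mul]

theorem pauliX_add (a b : Q → ZMod 2) : pauliX (a + b) = pauliX a * pauliX b := by
  ext t s
  rw [mul_pauliX_apply]
  simp [pauliX, add_assoc, add_comm a b]

theorem pauliZ_add (a b : Q → ZMod 2) : pauliZ (a + b) = pauliZ a * pauliZ b := by
  ext t s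
  rw [mul_pauliZ_apply, pauliZ, pauliZ, Matrix.diagonal_apply, Matrix.diagonal_apply]
  split_ifs with h
  · subst h
    rw [add_dotProduct, zmodSign_add]
  · simp

theorem pauliZ_mul_pauliX (a b : Q → ZMod 2) :
    pauliZ b * pauliX a = zmodSign (b ⬝ᵥ a) • (pauliX a * pauliZ b) := by
  ext t s
  rw [pauliZ_mul_apply, Matrix.smul_apply, mul_pauliZ_apply]
  unfold pauliX
  split_ifs with h
  · subst h
    rw [dotProduct_add, zmodSign_add, smul_eq_mul]
    ring
  · simp

theorem pauliX_mul_self (a : Q → ZMod 2) : pauliX a * pauliX a = 1 := by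
  rw [← pauliX_add, function_add_self, pauliX_zero]

theorem pauliZ_mul_self (a : Q → ZMod 2) : pauliZ a * pauliZ a = 1 := by
  rw [← pauliZ_add, function_add_self, pauliZ_zero]

/-- The set of `Z`-type operators in a group of operators, as a subspace. -/
def pauliZSpace (G : Submonoid (QOp Q)) : Submodule (ZMod 2) (Q → ZMod 2) where
  carrier := {a | pauliZ a ∈ G}
  zero_mem' := by simp [pauliZ_zero]
  add_mem' ha hb := by
    simp only [Set.mem_ofPred_eq, pauliZ_add] at *
    exact mul_mem ha hb
  smul_mem' c a ha := by
    rcases zmod_two_cases c with rfl | rfl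
    · simp [pauliZ_zero]
    · simpa using ha

theorem mem_pauliZSpace {G : Submonoid (QOp Q)} {a : Q → ZMod 2} :
    a ∈ pauliZSpace G ↔ pauliZ a ∈ G := Iff.rfl

end Pauli

/-! ## Hadamard gates on top of a linear change of basis -/

/-- The matrix entries of a Hadamard gate (if `p`) or of the identity. -/
def gateEntry (p : Prop) (a b : ZMod 2) : ℂ :=
  if p then zmodSign (a * b) * (((√2)⁻¹ : ℝ) : ℂ) else if a = b then 1 else 0

theorem gateEntry_conj (p : Prop) (a b : ZMod 2) : star (gateEntry p a b) = gateEntry p a b := by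
  unfold gateEntry
  split_ifs
  · rw [star_mul', star_zmodSign]
    simp
  · simp
  · simp

theorem gateEntry_comm (p : Prop) (a b : ZMod 2) : gateEntry p a b = gateEntry p b a := by
  unfold gateEntry
  rw [mul_comm a b]
  simp only [eq_comm]

/-- Orthonormality of rows: the product of Hadamard rows a and b is half the character of a + b,
whose sum vanishes unless a = b. -/
theorem sum_gateEntry_mul (p : Prop) (a b : ZMod 2) :
    ∑ x, gateEntry p a x * gateEntry p b x = if a = b then 1 else 0 := by
  have h2 : (((√2)⁻¹ : ℝ) : ℂ) * (((√2)⁻¹ : ℝ) : ℂ) = 1 / 2 := by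
    rw [← Complex.ofReal_mul, ← mul_inv, Real.mul_self_sqrt (by norm_num)]
    norm_num
  by_cases hp : p
  · have : ∀ x, gateEntry p a x * gateEntry p b x = zmodSign ((a + b) * x) * (1 / 2) := by
      intro x
      rw [← h2, add_mul, zmodSign_add]
      simp only [gateEntry, if_pos hp]
      ring
    simp only [this]
    rw [show (Finset.univ : Finset (ZMod 2)) = {0, 1} from rfl, Finset.sum_pair (by decide)]
    rcases zmod_two_cases a with rfl | rfl <;> rcases zmod_two_cases b with rfl | rfl <;>
      simp [zmodSign, CharTwo.add_self_eq_zero] <;> norm_num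
  · simp [gateEntry, if_neg hp]

section Gate

variable {Q Q' : Type*} [Fintype Q']

/-- The operator that maps the basis state `s` to `M s` and then applies Hadamard gates to the qubits
in `S`. -/
def linearGate (M : (Q → ZMod 2) → (Q' → ZMod 2)) (S : Set Q') :
    Matrix (Q' → ZMod 2) (Q → ZMod 2) ℂ :=
  fun t s => ∏ q, gateEntry (q ∈ S) (t q) (M s q)

theorem sum_prod_gateEntry [DecidableEq Q'] (S : Set Q') (t t' : Q' → ZMod 2) :
    ∑ s : Q' → ZMod 2, (∏ q, gateEntry (q ∈ S) (t q) (s q)) *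
      (∏ q, gateEntry (q ∈ S) (t' q) (s q)) = if t = t' then 1 else 0 := by
  simp only [← Finset.prod_mul_distrib]
  rw [← Fintype.prod_sum (fun q x => gateEntry (q ∈ S) (t q) x * gateEntry (q ∈ S) (t' q) x)]
  simp only [sum_gateEntry_mul]
  split_ifs with h
  · simp [h]
  · obtain ⟨q, hq⟩ := Function.ne_iff.1 h
    exact Finset.prod_eq_zero (Finset.mem_univ q) (if_neg hq)

variable [Fintype Q] [DecidableEq Q] [DecidableEq Q']

theorem linearGate_mul_conjTranspose (M : (Q → ZMod 2) → (Q' → ZMod 2))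
    (hM : Function.Bijective M) (S : Set Q') :
    linearGate M S * (linearGate M S).conjTranspose = 1 := by
  ext t t'
  rw [Matrix.mul_apply, Matrix.one_apply]
  simp only [Matrix.conjTranspose_apply, linearGate, star_prod, gateEntry_conj]
  rw [hM.sum_comp (fun s => (∏ q, gateEntry (q ∈ S) (t q) (s q)) *
      (∏ q, gateEntry (q ∈ S) (t' q) (s q))), sum_prod_gateEntry]

omit [DecidableEq Q] in
theorem linearGate_conjTranspose_mul (M : (Q → ZMod 2) → (Q' → ZMod 2))
    (hM : Function.Bijective M) (S : Set Q') :
    (linearGate M S).conjTranspose * linearGate M S = 1 := by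
  ext s s'
  rw [Matrix.mul_apply, Matrix.one_apply]
  simp only [Matrix.conjTranspose_apply, linearGate, star_prod, gateEntry_conj]
  simp only [gateEntry_comm _ _ (M _ _)]
  rw [sum_prod_gateEntry]
  simp only [hM.1.eq_iff]

/-- By linearity a flip by `a` becomes a flip by `M a`; the Hadamards then exchange `X` for `Z` on
`S`. -/
theorem linearGate_mul_pauliX (M : (Q → ZMod 2) →ₗ[ZMod 2] (Q' → ZMod 2)) (S : Set Q')
    (a : Q → ZMod 2) :
    linearGate M S * pauliX a =
      pauliZ (S.indicator (M a)) * pauliX (Sᶜ.indicator (M a)) * linearGate M S := by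
  ext t s
  rw [mul_pauliX_apply, Matrix.mul_assoc, pauliZ_mul_apply, pauliX_mul_apply, dotProduct, zmodSign_sum]
  unfold linearGate
  rw [map_add, ← Finset.prod_mul_distrib]
  refine Finset.prod_congr rfl fun q _ => ?_
  simp only [Pi.add_apply]
  by_cases hq : q ∈ S
  · simp only [gateEntry, hq, if_true, Set.indicator_of_mem, Set.mem_compl_iff, not_true,
      not_false_eq_true, Set.indicator_of_notMem, add_zero, mul_add, zmodSign_add]
    rw [mul_comm (t q) (M a q)]
    ring
  · simp only [gateEntry, hq, if_false, Set.mem_compl_iff, not_false_eq_true,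
      Set.indicator_of_mem, Set.indicator_of_notMem, zero_mul, zmodSign_zero, one_mul]
    refine if_congr ⟨fun h => ?_, fun h => ?_⟩ rfl rfl
    · rw [h, add_assoc, CharTwo.add_self_eq_zero, add_zero]
    · rw [← h, add_assoc, CharTwo.add_self_eq_zero, add_zero]

/-- `Z`-supports transform contragrediently: `z` is the pullback of `b` along `M`. Keeping `b` off
`S` ensures that no Hadamard acts on it. -/
theorem linearGate_mul_pauliZ (M : (Q → ZMod 2) → (Q' → ZMod 2)) (S : Set Q')
    {z : Q → ZMod 2} {b : Q' → ZMod 2} (hb : ∀ q ∈ S, b q = 0) (h : ∀ s, z ⬝ᵥ s = b ⬝ᵥ M s) :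
    linearGate M S * pauliZ z = pauliZ b * linearGate M S := by
  ext t s
  rw [mul_pauliZ_apply, pauliZ_mul_apply, mul_comm]
  -- Off `S` the gate is a permutation of basis states, so other entries vanish.
  by_cases ht : ∀ q, q ∉ S → t q = M s q
  · rw [h]
    congr 2
    refine Finset.sum_congr rfl fun q _ => ?_
    by_cases hq : q ∈ S
    · simp [hb q hq]
    · rw [ht q hq]
  · push Not at ht
    obtain ⟨q, hq, hne⟩ := ht
    have : linearGate M S t s = 0 :=
      Finset.prod_eq_zero (Finset.mem_univ q) (by simp [gateEntry, hq, hne])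
    simp [this]

end Gate

theorem tensorBlocks_linearGate {Q Q' B : Type*} [Fintype Q'] [Fintype B]
    (block : Q → B) (block' : Q' → B) (S : Set Q')
    (M : ∀ b, ({q // block q = b} → ZMod 2) → ({q // block' q = b} → ZMod 2)) :
    tensorBlocks block block' (fun b => linearGate (M b) (Subtype.val ⁻¹' S)) =
      linearGate (fun s q => M (block' q) (fun p => s p.1) ⟨q, rfl⟩) S := by
  ext t s
  unfold tensorBlocks linearGate
  rw [← Fintype.prod_fiberwise block' (fun q => gateEntry (q ∈ S) (t q)
    (M (block' q) (fun p => s p.1) ⟨q, rfl⟩))]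
  refine Finset.prod_congr rfl fun b _ => ?_
  refine Finset.prod_congr (by congr) fun q _ => ?_
  obtain ⟨q, rfl⟩ := q
  rfl

/-! ## Local equivalence from a linear map -/

/-- An injective linear map extends along another one to an isomorphism, if dimensions permit. -/
theorem exists_linearEquiv_extending {K A X W : Type*} [Field K] [AddCommGroup A] [Module K A]
    [AddCommGroup X] [Module K X] [AddCommGroup W] [Module K W] [FiniteDimensional K X]
    [FiniteDimensional K W] (f : A →ₗ[K] X) (g : A →ₗ[K] W) (hf : Function.Injective f)
    (hg : Function.Injective g) (h : Module.finrank K X = Module.finrank K W) :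
    ∃ M : X ≃ₗ[K] W, ∀ a, M (f a) = g a := by
  obtain ⟨p, hp⟩ := Submodule.exists_isCompl (LinearMap.range f)
  obtain ⟨r, hr⟩ := Submodule.exists_isCompl (LinearMap.range g)
  have h1 := Submodule.finrank_add_eq_of_isCompl hp
  have h2 := Submodule.finrank_add_eq_of_isCompl hr
  have e₁ := (LinearEquiv.ofInjective f hf).finrank_eq
  have e₂ := (LinearEquiv.ofInjective g hg).finrank_eq
  let e : p ≃ₗ[K] r := LinearEquiv.ofFinrankEq _ _ (by omega)
  let e' := (LinearEquiv.ofInjective f hf).symm.trans (LinearEquiv.ofInjective g hg)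
  refine ⟨(Submodule.prodEquivOfIsCompl _ _ hp).symm.trans
    ((e'.prodCongr e).trans (Submodule.prodEquivOfIsCompl _ _ hr)), fun a => ?_⟩
  have h3 : (Submodule.prodEquivOfIsCompl _ _ hp).symm (f a) =
      (LinearEquiv.ofInjective f hf a, 0) :=
    Submodule.prodEquivOfIsCompl_symm_apply_left _ _ hp (LinearEquiv.ofInjective f hf a)
  simp [h3, e']

section Blocks

variable {Q Q' B : Type*} {block : Q → B} {block' : Q' → B}

/-- The linear map on all qubits given by linear maps on the qubits of each block. -/
def blockMap (M : ∀ b, ({q // block q = b} → ZMod 2) →ₗ[ZMod 2] ({q // block' q = b} → ZMod 2)) :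
    (Q → ZMod 2) →ₗ[ZMod 2] (Q' → ZMod 2) where
  toFun s q := M (block' q) (fun p => s p.1) ⟨q, rfl⟩
  map_add' s t := by
    ext q
    exact congrFun (map_add (M (block' q)) (fun p => s p.1) (fun p => t p.1)) _
  map_smul' c s := by
    ext q
    exact congrFun (map_smul (M (block' q)) c (fun p => s p.1)) _

theorem blockMap_restrict (M : ∀ b, ({q // block q = b} → ZMod 2) →ₗ[ZMod 2]
    ({q // block' q = b} → ZMod 2)) (s : Q → ZMod 2) (b : B) :
    (fun p : {q // block' q = b} => blockMap M s p.1) = M b fun p => s p.1 := by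
  ext ⟨q, rfl⟩
  rfl

/-- The isomorphism on all qubits given by isomorphisms on the qubits of each block. -/
def blockEquiv (M : ∀ b, ({q // block q = b} → ZMod 2) ≃ₗ[ZMod 2] ({q // block' q = b} → ZMod 2)) :
    (Q → ZMod 2) ≃ₗ[ZMod 2] (Q' → ZMod 2) :=
  LinearEquiv.ofLinearMap (blockMap fun b => (M b).toLinearMap)
    (blockMap fun b => (M b).symm.toLinearMap)
    (by
      ext1 s; ext q
      change M (block' q) (fun p => blockMap (fun b => (M b).symm.toLinearMap) s p.1) ⟨q, rfl⟩ = _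
      rw [blockMap_restrict]
      simp)
    (by
      ext1 s; ext q
      change (M (block q)).symm (fun p => blockMap (fun b => (M b).toLinearMap) s p.1) ⟨q, rfl⟩ = _
      rw [blockMap_restrict]
      simp)

end Blocks

/-- Locality makes `N` block diagonal, so it is injective on each block and extends there once
ancillas equalize the dimensions. Injectivity also keeps the natural-number subtraction in `hcard`
from truncating. -/
theorem exists_local_extension {Q A W B : Type*} [Fintype Q] [Fintype A] [Fintype W]
    (block : Q → B) (blockA : A → B) (block' : W → B)
    (N : (Q → ZMod 2) →ₗ[ZMod 2] (W → ZMod 2)) (hN : Function.Injective N)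
    (hloc : ∀ x w, (∀ q, block q = block' w → x q = 0) → N x w = 0)
    (hcard : ∀ b, Fintype.card {a // blockA a = b} =
      Fintype.card {w // block' w = b} - Fintype.card {q // block q = b}) :
    ∃ M : ∀ b, ({q // Sum.elim block blockA q = b} → ZMod 2) ≃ₗ[ZMod 2]
        ({w // block' w = b} → ZMod 2),
      ∀ x, blockEquiv M (Sum.elim x 0) = N x := by
  have key : ∀ b, ∃ M : ({q // Sum.elim block blockA q = b} → ZMod 2) ≃ₗ[ZMod 2]
      ({w // block' w = b} → ZMod 2), ∀ (x : Q → ZMod 2) (w),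
      M (fun p => (Sum.elim x 0 : Q ⊕ A → ZMod 2) p.1) w = N x w.1 := by
    intro b
    let ext : ({q // block q = b} → ZMod 2) →ₗ[ZMod 2] (Q → ZMod 2) :=
      { toFun := fun x q => if h : block q = b then x ⟨q, h⟩ else 0
        map_add' := fun x y => by ext q; by_cases h : block q = b <;> simp [h]
        map_smul' := fun c x => by ext q; by_cases h : block q = b <;> simp [h] }
    have hext : ∀ x (q : Q) (h : block q = b), ext x q = x ⟨q, h⟩ := fun x q h => dif_pos h
    have hext' : ∀ x (q : Q) (h : block q ≠ b), ext x q = 0 := fun x q h => dif_neg h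
    let g : ({q // block q = b} → ZMod 2) →ₗ[ZMod 2] ({w // block' w = b} → ZMod 2) :=
      LinearMap.funLeft _ _ Subtype.val ∘ₗ N ∘ₗ ext
    have hg : Function.Injective g := by
      rw [← LinearMap.ker_eq_bot, LinearMap.ker_eq_bot']
      intro x hx
      have h0 : N (ext x) = 0 := by
        ext w
        by_cases hw : block' w = b
        · exact congrFun hx ⟨w, hw⟩
        · exact hloc _ _ fun q hq => hext' _ _ fun h => hw (hq ▸ h)
      have h1 : ext x = 0 := hN (by rw [h0, map_zero])
      ext ⟨q, hq⟩
      rw [← hext x q hq, h1]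
      rfl
    let f : ({q // block q = b} → ZMod 2) →ₗ[ZMod 2]
        ({q // Sum.elim block blockA q = b} → ZMod 2) :=
      { toFun := fun x p => (Sum.elim (ext x) 0 : Q ⊕ A → ZMod 2) p.1
        map_add' := fun x y => by ext ⟨q | q, h⟩ <;> simp
        map_smul' := fun c x => by ext ⟨q | q, h⟩ <;> simp }
    have hf : Function.Injective f := by
      intro x y hxy
      ext ⟨q, hq⟩
      have := congrFun hxy ⟨Sum.inl q, hq⟩
      rw [← hext x q hq, ← hext y q hq]
      exact this
    have hle : Fintype.card {q // block q = b} ≤ Fintype.card {w // block' w = b} := by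
      have := LinearMap.finrank_le_finrank_of_injective hg
      simpa using this
    have hdim : Fintype.card {q // Sum.elim block blockA q = b} =
        Fintype.card {w // block' w = b} := by
      let e : {q // Sum.elim block blockA q = b} ≃ {q // block q = b} ⊕ {a // blockA a = b} :=
        Equiv.subtypeSum
      rw [Fintype.card_congr e, Fintype.card_sum, hcard]
      omega
    obtain ⟨M, hM⟩ := exists_linearEquiv_extending f g hf hg (by simpa using hdim)
    refine ⟨M, fun x w => ?_⟩
    have h1 : (fun p : {q // Sum.elim block blockA q = b} =>
        (Sum.elim x 0 : Q ⊕ A → ZMod 2) p.1) = f fun q => x q.1 := by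
      ext ⟨q | q, h⟩
      · exact (hext (fun q => x q.1) q h).symm
      · rfl
    rw [h1, hM]
    change N (ext fun q => x q.1) w.1 = N x w.1
    have h2 := hloc ((ext fun q => x q.1) - x) w.1 (fun q hq => by
      rw [Pi.sub_apply, hext _ q (hq.trans w.2), sub_self])
    rw [map_sub, Pi.sub_apply, sub_eq_zero] at h2
    exact h2
  choose M hM using key
  refine ⟨M, fun x => ?_⟩
  ext w
  exact hM (block' w) x ⟨w, rfl⟩

theorem indicator_inl {Q A : Type*} (s : Set Q) :
    ((Sum.inl '' s : Set (Q ⊕ A)).indicator 1 : Q ⊕ A → ZMod 2) = Sum.elim (s.indicator 1) 0 := by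
  ext (q | a) <;> simp [Set.indicator]

theorem indicator_singleton_one {Q : Type*} [DecidableEq Q] (q : Q) :
    (({q} : Set Q).indicator 1 : Q → ZMod 2) = Pi.single q 1 := by
  ext p
  by_cases h : p = q
  · subst h; simp
  · simp [h]

theorem sumElim_dotProduct {Q A : Type*} [Fintype Q] [Fintype A] (x : Q → ZMod 2) (y : A → ZMod 2)
    (s : Q ⊕ A → ZMod 2) :
    Sum.elim x y ⬝ᵥ s = (x ⬝ᵥ fun q => s (Sum.inl q)) + y ⬝ᵥ fun a => s (Sum.inr a) := by
  simp [dotProduct]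

theorem linearMap_dotProduct_exists {Q W : Type*} [Fintype Q] [Fintype W]
    (N : (Q → ZMod 2) →ₗ[ZMod 2] (W → ZMod 2)) (b : W → ZMod 2) :
    ∃ z : Q → ZMod 2, ∀ s, z ⬝ᵥ s = b ⬝ᵥ N s := by
  refine ⟨Matrix.vecMul b (LinearMap.toMatrix' N), fun s => ?_⟩
  rw [← Matrix.dotProduct_mulVec, LinearMap.toMatrix'_mulVec]

/-! ### Stabilizer groups under conjugation by a linear gate -/

namespace CSSCode

variable {Q : Type*}

/-- The space spanned by the supports of the `Z`-type generators. -/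
def zSpace (C : CSSCode Q) : Submodule (ZMod 2) (Q → ZMod 2) :=
  Submodule.span (ZMod 2) ((fun s => (s.indicator 1 : Q → ZMod 2)) '' C.zs)

theorem indicator_mem_zSpace {C : CSSCode Q} {s : Set Q} (hs : s ∈ C.zs) :
    (s.indicator 1 : Q → ZMod 2) ∈ C.zSpace := Submodule.subset_span ⟨s, hs, rfl⟩

theorem mem_zSpace_withAncillas {A : Type*} [Fintype A] (C : CSSCode Q)
    {b : Q ⊕ A → ZMod 2} (hb : (fun q => b (Sum.inl q)) ∈ C.zSpace) :
    b ∈ (C.withAncillas A).zSpace := by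
  have h1 : C.zSpace ≤ (C.withAncillas A).zSpace.comap
        ({ toFun := fun x => Sum.elim x 0
           map_add' := fun x y => by ext (q | q) <;> simp
           map_smul' := fun c x => by ext (q | q) <;> simp } :
          (Q → ZMod 2) →ₗ[ZMod 2] (Q ⊕ A → ZMod 2)) := by
    refine Submodule.span_le.2 ?_
    rintro _ ⟨s, hs, rfl⟩
    change (Sum.elim (s.indicator 1) 0 : Q ⊕ A → ZMod 2) ∈ (C.withAncillas A).zSpace
    rw [← indicator_inl]
    exact indicator_mem_zSpace (Or.inl ⟨s, hs, rfl⟩)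
  have h2 : ∀ a : A, ({Sum.inr a} : Set (Q ⊕ A)).indicator 1 ∈ (C.withAncillas A).zSpace :=
    fun a => indicator_mem_zSpace (Or.inr ⟨a, rfl⟩)
  have h3 : b = Sum.elim (fun q => b (Sum.inl q)) 0 +
      ∑ a : A, b (Sum.inr a) • ({Sum.inr a} : Set (Q ⊕ A)).indicator 1 := by
    ext (q | a)
    · simp [Finset.sum_apply]
    · rw [Pi.add_apply, Finset.sum_apply, Finset.sum_eq_single a]
      · simp
      · intro a' _ h
        simp [h.symm]
      · simp
  rw [h3]
  exact add_mem (h1 hb) (sum_mem fun a _ => Submodule.smul_mem _ _ (h2 a))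

theorem pauliX_mem_stabilizer [Fintype Q] {C : CSSCode Q} {s : Set Q} (hs : s ∈ C.xs) :
    pauliX (s.indicator 1) ∈ C.stabilizer :=
  Submonoid.subset_closure (Or.inl ⟨s, hs, rfl⟩)

theorem pauliZ_mem_stabilizer [Fintype Q] {C : CSSCode Q} {b : Q → ZMod 2} (hb : b ∈ C.zSpace) :
    pauliZ b ∈ C.stabilizer := by
  have : C.zSpace ≤ pauliZSpace C.stabilizer := by
    refine Submodule.span_le.2 ?_
    rintro _ ⟨s, hs, rfl⟩
    exact Submonoid.subset_closure (Or.inr ⟨s, hs, zOp_eq_pauliZ s⟩)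
  exact this hb

/-- Conjugation is a homomorphism, so generators suffice in both directions. The single-qubit `Z` on
`S` are images of `X`-generators by `hS`, and they absorb the `Z`-part that the Hadamards produce
from any other `X`-generator. -/
theorem image_stabilizer_linearGate {Q' : Type*} [Fintype Q] [Fintype Q'] {C : CSSCode Q}
    {C' : CSSCode Q'} (T : (Q → ZMod 2) ≃ₗ[ZMod 2] (Q' → ZMod 2)) (S : Set Q')
    (hS : ∀ s ∈ S, ∃ A ∈ C.xs, T (A.indicator 1) = ({s} : Set Q').indicator 1)
    (hSz : ∀ s ∈ S, {s} ∈ C'.zs)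
    (hX : ∀ A ∈ C.xs, Sᶜ.indicator (T (A.indicator 1)) = 0 ∨
      ∃ A' ∈ C'.xs, Sᶜ.indicator (T (A.indicator 1)) = A'.indicator 1)
    (hX' : ∀ A' ∈ C'.xs, ∃ A ∈ C.xs, Sᶜ.indicator (T (A.indicator 1)) = A'.indicator 1)
    (hZ : ∀ A ∈ C.zs, ∃ b ∈ C'.zSpace, (∀ s ∈ S, b s = 0) ∧
      ∀ s, A.indicator 1 ⬝ᵥ s = b ⬝ᵥ T s)
    (hZ' : ∀ A' ∈ C'.zs, (∃ s ∈ S, A' = {s}) ∨ Disjoint A' S ∧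
      ∃ z ∈ C.zSpace, ∀ s, z ⬝ᵥ s = A'.indicator 1 ⬝ᵥ T s) :
    (fun P : QOp Q => linearGate T S * P * (linearGate T S).conjTranspose) ''
      (C.stabilizer : Set (QOp Q)) = C'.stabilizer := by
  let U := linearGate T S
  have hU1 : U.conjTranspose * U = 1 := linearGate_conjTranspose_mul _ T.bijective _
  have hU2 : U * U.conjTranspose = 1 := linearGate_mul_conjTranspose _ T.bijective _
  let φ : QOp Q →* QOp Q' :=
    { toFun := fun P => U * P * U.conjTranspose
      map_one' := by rw [Matrix.mul_one, hU2]
      map_mul' := fun P P' => by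
        have : U * (P * P') * U.conjTranspose =
            U * P * (U.conjTranspose * U) * P' * U.conjTranspose := by
          rw [hU1, Matrix.mul_one, Matrix.mul_assoc U P P']
        rw [this]
        simp only [Matrix.mul_assoc] }
  have hφ : ∀ (P : QOp Q) (P' : QOp Q'), U * P = P' * U → φ P = P' := fun P P' h => by
    have : U * P * U.conjTranspose = P' := by rw [h, Matrix.mul_assoc, hU2, Matrix.mul_one]
    exact this
  change φ '' _ = _
  rw [← Submonoid.coe_map]
  congr 1
  have hφX : ∀ A : Set Q, φ (xOp A) =
      pauliZ (S.indicator (T (A.indicator 1))) * pauliX (Sᶜ.indicator (T (A.indicator 1))) :=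
    fun A => hφ _ _ (linearGate_mul_pauliX T.toLinearMap _ _)
  have hφZ : ∀ z b, (∀ s ∈ S, b s = 0) → (∀ s, z ⬝ᵥ s = b ⬝ᵥ T s) →
      φ (pauliZ z) = pauliZ b := fun z b hb h => hφ _ _ (linearGate_mul_pauliZ _ _ hb h)
  have hφS : ∀ s ∈ S, pauliZ (({s} : Set Q').indicator 1) ∈ C.stabilizer.map φ := by
    intro s hs
    obtain ⟨A, hA, h⟩ := hS s hs
    have h1 := hφX A
    rw [h, Set.indicator_indicator, Set.indicator_indicator,
      Set.inter_eq_right.2 (Set.singleton_subset_iff.2 hs),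
      show Sᶜ ∩ {s} = (∅ : Set Q') by ext s'; simp; rintro h' rfl; exact h' hs,
      Set.indicator_empty, show (fun _ : Q' => (0 : ZMod 2)) = 0 from rfl, pauliX_zero,
      mul_one] at h1
    rw [← h1]
    exact Submonoid.mem_map_of_mem φ (pauliX_mem_stabilizer hA)
  have hspan : ∀ (P : Submodule (ZMod 2) (Q' → ZMod 2)) (w : Q' → ZMod 2),
      (∀ s ∈ S, ({s} : Set Q').indicator 1 ∈ P) → S.indicator w ∈ P := by
    intro P w hP
    have h1 : S.indicator w = ∑ s, S.indicator w s • ({s} : Set Q').indicator 1 := by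
      ext s
      rw [Finset.sum_apply, Finset.sum_eq_single s]
      · simp
      · intro a' _ h
        simp [h.symm]
      · simp
    rw [h1]
    refine sum_mem fun s _ => ?_
    by_cases hs : s ∈ S
    · exact Submodule.smul_mem _ _ (hP s hs)
    · rw [Set.indicator_of_notMem hs, zero_smul]
      exact zero_mem _
  apply le_antisymm
  · conv_lhs => unfold CSSCode.stabilizer
    rw [MonoidHom.map_mclosure, Submonoid.closure_le]
    rintro _ ⟨_, ⟨A, hA, rfl⟩ | ⟨A, hA, rfl⟩, rfl⟩
    · rw [hφX A]
      refine mul_mem (pauliZ_mem_stabilizer (hspan _ _ fun s hs =>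
        indicator_mem_zSpace (hSz s hs))) ?_
      rcases hX A hA with h | ⟨A', hA', h⟩
      · rw [h, pauliX_zero]
        exact one_mem _
      · rw [h]
        exact pauliX_mem_stabilizer hA'
    · obtain ⟨b, hb, hbS, h⟩ := hZ A hA
      rw [zOp_eq_pauliZ, hφZ _ b hbS h]
      exact pauliZ_mem_stabilizer hb
  · conv_lhs => unfold CSSCode.stabilizer
    refine Submonoid.closure_le.2 ?_
    rintro _ (⟨A', hA', rfl⟩ | ⟨A', hA', rfl⟩)
    · obtain ⟨A, hA, h⟩ := hX' A' hA'
      -- Multiplying by the `Z`-part on `S`, already in the image, leaves the pure `X`-operator.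
      have h1 := mul_mem (mem_pauliZSpace.1 (hspan (pauliZSpace (C.stabilizer.map φ))
        (T (A.indicator 1)) hφS))
        (Submonoid.mem_map_of_mem φ (pauliX_mem_stabilizer hA))
      rw [← xOp_eq_pauliX, hφX A, ← mul_assoc, pauliZ_mul_self, one_mul, h] at h1
      exact h1
    · rcases hZ' A' hA' with ⟨s, hs, rfl⟩ | ⟨hd, z, hz, h⟩
      · rw [zOp_eq_pauliZ]
        exact hφS s hs
      · rw [zOp_eq_pauliZ, ← hφZ z _ (fun s hs => Set.indicator_of_notMem
          (fun h' => Set.disjoint_left.1 hd h' hs) _) h]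
        exact Submonoid.mem_map_of_mem φ (pauliZ_mem_stabilizer hz)

end CSSCode

/-- The isomorphism extending `N` is arbitrary on the ancillas, so the image of a `Z`-generator is
known only modulo functionals that vanish on the range of `N`. By `hker` these are stabilizers of
`C'` up to ancillas, so the arbitrary choice does no harm. `S` marks the ancillas that receive a
Hadamard; the remaining ancillas of `C'` are untouched by `N`. -/
theorem locallyEquivalent_of_linearMap {Q Q' B : Type*} [Fintype Q] [Fintype Q'] [Fintype B]
    {block : Q → B} {block' : Q' → B} {C : CSSCode Q} {C' : CSSCode Q'} (n' : B → ℕ)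
    (N : (Q → ZMod 2) →ₗ[ZMod 2] (Q' ⊕ (Σ b, Fin (n' b)) → ZMod 2)) (hN : Function.Injective N)
    (hloc : ∀ x w, (∀ q, block q = Sum.elim block' Sigma.fst w → x q = 0) → N x w = 0)
    (S : Set (Σ b, Fin (n' b)))
    (hS : ∀ s ∈ S, ∃ A ∈ C.xs,
      N (A.indicator 1) = ({Sum.inr s} : Set (Q' ⊕ (Σ b, Fin (n' b)))).indicator 1)
    (hS' : ∀ s, s ∉ S → ∀ x, N x (Sum.inr s) = 0)
    (hX : ∀ A ∈ C.xs, (fun q => N (A.indicator 1) (Sum.inl q)) = 0 ∨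
      ∃ A' ∈ C'.xs, (fun q => N (A.indicator 1) (Sum.inl q)) = A'.indicator 1)
    (hX' : ∀ A' ∈ C'.xs, ∃ A ∈ C.xs, (fun q => N (A.indicator 1) (Sum.inl q)) = A'.indicator 1)
    (hZ : ∀ A ∈ C.zs, ∃ A' ∈ C'.zs, ∀ x, A.indicator 1 ⬝ᵥ x =
      A'.indicator 1 ⬝ᵥ fun q => N x (Sum.inl q))
    (hZ' : ∀ A' ∈ C'.zs, ∃ A ∈ C.zs, ∀ x, A.indicator 1 ⬝ᵥ x =
      A'.indicator 1 ⬝ᵥ fun q => N x (Sum.inl q))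
    (hker : ∀ b, (∀ x, b ⬝ᵥ N x = 0) → (fun q => b (Sum.inl q)) ∈ C'.zSpace) :
    LocallyEquivalent block block' C C' := by
  let n : B → ℕ := fun b => Fintype.card
    {w // Sum.elim block' (Sigma.fst (β := fun b => Fin (n' b))) w = b} -
    Fintype.card {q // block q = b}
  obtain ⟨M, hM⟩ := exists_local_extension block (Sigma.fst (β := fun b => Fin (n b)))
    (Sum.elim block' Sigma.fst) N hN hloc (fun b => by
      rw [Fintype.card_congr (Equiv.sigmaSubtype b), Fintype.card_fin])
  let T := blockEquiv M
  have hTN : ∀ x, T (Sum.elim x 0) = N x := hM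
  have hTX : ∀ A : Set Q, (Sum.inr '' S : Set (Q' ⊕ (Σ b, Fin (n' b))))ᶜ.indicator
      (T ((Sum.inl '' A : Set (Q ⊕ (Σ b, Fin (n b)))).indicator 1)) =
      Sum.elim (fun q => N (A.indicator 1) (Sum.inl q)) 0 := by
    intro A
    rw [indicator_inl, hTN]
    ext (q | s)
    · simp
    · by_cases h : s ∈ S
      · simp [h]
      · simp [h, hS' s h]
  have main := CSSCode.image_stabilizer_linearGate (C := C.withAncillas (Σ b, Fin (n b)))
    (C' := C'.withAncillas (Σ b, Fin (n' b))) T (Sum.inr '' S) ?_ ?_ ?_ ?_ ?_ ?_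
  · refine ⟨n, n', fun b => linearGate (M b) (Subtype.val ⁻¹' (Sum.inr '' S)), fun b =>
      ⟨linearGate_conjTranspose_mul _ (M b).bijective _,
        linearGate_mul_conjTranspose _ (M b).bijective _⟩, ?_⟩
    rw [tensorBlocks_linearGate]
    convert main <;> rfl
  · rintro _ ⟨s, hs, rfl⟩
    obtain ⟨A, hA, h⟩ := hS s hs
    refine ⟨_, ⟨A, hA, rfl⟩, ?_⟩
    rw [indicator_inl, hTN, h]
  · rintro _ ⟨s, hs, rfl⟩
    exact Or.inr ⟨s, rfl⟩
  · rintro _ ⟨A, hA, rfl⟩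
    rw [hTX]
    rcases hX A hA with h | ⟨A', hA', h⟩
    · left
      rw [h]
      ext (q | s) <;> rfl
    · right
      refine ⟨_, ⟨A', hA', rfl⟩, ?_⟩
      rw [h, indicator_inl]
  · rintro _ ⟨A', hA', rfl⟩
    obtain ⟨A, hA, h⟩ := hX' A' hA'
    refine ⟨_, ⟨A, hA, rfl⟩, ?_⟩
    rw [hTX, h, indicator_inl]
  · intro D hD
    obtain ⟨b, hb⟩ := linearMap_dotProduct_exists T.symm.toLinearMap (D.indicator 1)
    have hb' : ∀ s, D.indicator 1 ⬝ᵥ s = b ⬝ᵥ T s := fun s => by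
      rw [hb]
      simp
    have hbN : (fun q => b (Sum.inl q)) ∈ C'.zSpace ∧
        ∃ A', ∀ x, b ⬝ᵥ N x = Sum.elim A' 0 ⬝ᵥ N x := by
      rcases hD with ⟨A, hA, rfl⟩ | ⟨a, rfl⟩
      · obtain ⟨A', hA', h⟩ := hZ A hA
        have h1 : ∀ x, b ⬝ᵥ N x = Sum.elim (A'.indicator 1) 0 ⬝ᵥ N x := fun x => by
          rw [← hTN, ← hb', indicator_inl, sumElim_dotProduct, hTN, sumElim_dotProduct]
          simpa using h x
        refine ⟨?_, _, h1⟩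
        -- `b` and the expected generator `A'` agree on the range of `N`, so they differ by a
        -- stabilizer.
        have h2 := hker (b - Sum.elim (A'.indicator 1) 0) fun x => by
          rw [sub_dotProduct, h1, sub_self]
        have h3 := add_mem h2 (CSSCode.indicator_mem_zSpace hA')
        convert h3 using 1
        ext q
        simp
      · have h1 : ∀ x, b ⬝ᵥ N x = 0 := fun x => by
          rw [← hTN, ← hb', indicator_singleton_one]
          simp
        refine ⟨hker b h1, 0, fun x => ?_⟩
        rw [h1, sumElim_dotProduct]
        simp
    refine ⟨b, C'.mem_zSpace_withAncillas hbN.1, ?_, hb'⟩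
    rintro _ ⟨s, hs, rfl⟩
    obtain ⟨A, hA, h⟩ := hS s hs
    obtain ⟨A', h'⟩ := hbN.2
    -- Testing on the `X`-generator that `N` sends to the unit vector at `s` reads off the
    -- coefficient of `b` there, and the right side has no ancilla part.
    have := h' (A.indicator 1)
    rw [h, sumElim_dotProduct] at this
    simpa [indicator_singleton_one] using this
  · rintro _ (⟨A', hA', rfl⟩ | ⟨s, rfl⟩)
    · right
      refine ⟨Set.disjoint_left.2 (by rintro _ ⟨q, _, rfl⟩ ⟨s, _, h⟩; cases h), ?_⟩
      obtain ⟨A, hA, h⟩ := hZ' A' hA'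
      obtain ⟨z, hz⟩ := linearMap_dotProduct_exists T.toLinearMap
        (Sum.elim (A'.indicator 1) 0)
      refine ⟨z, C.mem_zSpace_withAncillas ?_, by rwa [indicator_inl]⟩
      have h1 : (fun q => z (Sum.inl q)) = A.indicator 1 := by
        refine dotProduct_eq _ _ fun x => ?_
        have h2 := hz (Sum.elim x 0)
        rw [LinearEquiv.coe_coe, hTN, sumElim_dotProduct, zero_dotProduct, add_zero, ← h] at h2
        rw [← h2]
        simp [dotProduct]
      rw [h1]
      exact CSSCode.indicator_mem_zSpace hA
    · by_cases hs : s ∈ S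
      · exact Or.inl ⟨_, ⟨s, hs, rfl⟩, rfl⟩
      · right
        refine ⟨by simpa using hs, ?_⟩
        obtain ⟨z, hz⟩ := linearMap_dotProduct_exists T.toLinearMap
          (({Sum.inr s} : Set (Q' ⊕ (Σ b, Fin (n' b)))).indicator 1)
        refine ⟨z, C.mem_zSpace_withAncillas ?_, hz⟩
        have h1 : (fun q => z (Sum.inl q)) = 0 := by
          refine dotProduct_eq _ _ fun x => ?_
          have h2 := hz (Sum.elim x 0)
          rw [LinearEquiv.coe_coe, hTN, indicator_singleton_one, single_dotProduct, hS' s hs,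
            mul_zero] at h2
          rw [zero_dotProduct, ← h2]
          simp [dotProduct]
        rw [h1]
        exact zero_mem _

namespace ColorGraph

/-! ## Components of the lattice -/

variable {V : Type*} (L : ColorGraph V) {S T : Set Color} {u v : V} {a b c d : Color}

theorem mem_comp_self (S : Set Color) (v : V) : v ∈ L.comp S v := MulAction.mem_orbit_self v

theorem comp_eq_of_mem (h : u ∈ L.comp S v) : L.comp S u = L.comp S v :=
  MulAction.orbit_eq_iff.2 h

theorem σ_mem_comp (ha : a ∈ S) (v : V) : L.σ a v ∈ L.comp S v :=
  ⟨⟨L.σ a, Subgroup.subset_closure ⟨a, ha, rfl⟩⟩, rfl⟩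

theorem comp_σ (ha : a ∈ S) (v : V) : L.comp S (L.σ a v) = L.comp S v :=
  L.comp_eq_of_mem (L.σ_mem_comp ha v)

theorem comp_subset {P : Set V} (hP : ∀ a ∈ S, ∀ u ∈ P, L.σ a u ∈ P) (hv : v ∈ P) :
    L.comp S v ⊆ P := by
  have key : ∀ g ∈ Subgroup.closure (L.σ '' S), ∀ u, u ∈ P → g u ∈ P := by
    intro g hg
    induction hg using Subgroup.closure_induction'' with
    | mem x hx =>
      obtain ⟨a, ha, rfl⟩ := hx
      exact hP a ha
    | inv_mem x hx =>
      obtain ⟨a, ha, rfl⟩ := hx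
      intro u hu
      have : (L.σ a)⁻¹ u = L.σ a u := by
        rw [Equiv.Perm.inv_eq_iff_eq, L.σ_σ]
      rw [this]
      exact hP a ha u hu
    | one => exact fun u hu => hu
    | mul x y _ _ hx hy => exact fun u hu => hx _ (hy u hu)
  rintro _ ⟨⟨g, hg⟩, rfl⟩
  exact key g hg v hv

theorem comp_mono (h : S ⊆ T) (v : V) : L.comp S v ⊆ L.comp T v :=
  L.comp_subset (fun a ha u hu => by
    rw [← L.comp_eq_of_mem hu]
    exact L.σ_mem_comp (h ha) u) (L.mem_comp_self T v)

theorem comp_singleton (a : Color) (v : V) : L.comp {a} v = {v, L.σ a v} := by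
  apply subset_antisymm
  · refine L.comp_subset ?_ (Or.inl rfl)
    rintro b rfl u (rfl | rfl)
    · exact Or.inr rfl
    · exact Or.inl (L.σ_σ _ _)
  · rintro u (rfl | rfl)
    · exact L.mem_comp_self _ _
    · exact L.σ_mem_comp (Set.mem_singleton a) v

theorem eq_comp_of_mem {s : Set V} (hs : s ∈ Set.range (L.comp S)) (hv : v ∈ s) :
    s = L.comp S v := by
  obtain ⟨w, rfl⟩ := hs
  exact (L.comp_eq_of_mem hv).symm

theorem nonempty_of_mem_range {s : Set V} (hs : s ∈ Set.range (L.comp S)) : s.Nonempty := by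
  obtain ⟨w, rfl⟩ := hs
  exact ⟨w, L.mem_comp_self S w⟩

/-- A function that does not change along edges with colors in `S` is constant on components. -/
theorem eq_of_mem_comp {β : Type*} {f : V → β} {P : Set V}
    (hP : ∀ a ∈ S, ∀ u ∈ P, L.σ a u ∈ P) (hf : ∀ a ∈ S, ∀ u ∈ P, f (L.σ a u) = f u)
    (hv : v ∈ P) (hu : u ∈ L.comp S v) : f u = f v :=
  (L.comp_subset (P := {w | w ∈ P ∧ f w = f v})
    (fun a ha w hw => ⟨hP a ha w hw.1, (hf a ha w hw.1).trans hw.2⟩) ⟨hv, rfl⟩ hu).2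

theorem σ_mem_of_mem_range {s : Set V} (hs : s ∈ Set.range (L.comp S)) (ha : a ∈ S) (hv : v ∈ s) :
    L.σ a v ∈ s := by
  rw [L.eq_comp_of_mem hs hv]
  exact L.σ_mem_comp ha v

/-! ## Cycles on the boundary of a cell -/

section Homology

variable (d) (c : Set V)

/-- The edges on the boundary of a cell `c` of color `d`. -/
abbrev CellEdge : Type _ := Σ a : {a : Color // a ≠ d}, {e : Set V // e ∈ L.edges a.1 ∧ e ⊆ c}

/-- The faces on the boundary of a cell `c` of color `d`. -/
abbrev CellFace : Type _ := Σ k : {a : Color // a ≠ d}, {f : Set V // f ∈ L.faces d k.1 ∧ f ⊆ c}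

variable {d c}

/-- The edge of color `a` at a vertex of the cell. -/
def cellEdge (hc : c ∈ L.cells d) (a : {a : Color // a ≠ d}) (v : c) : L.CellEdge d c :=
  ⟨a, L.comp {a.1} v.1, ⟨v.1, rfl⟩, by
    exact (L.comp_mono (Set.singleton_subset_iff.2 a.2) _).trans
      (L.eq_comp_of_mem hc v.2).superset⟩

/-- The face towards the cell of color `k` at a vertex of the cell. -/
def cellFace (hc : c ∈ L.cells d) (k : {a : Color // a ≠ d}) (v : c) : L.CellFace d c :=
  ⟨k, L.comp {d, k.1}ᶜ v.1, ⟨v.1, rfl⟩, by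
    exact (L.comp_mono (Set.compl_subset_compl.2 (by simp)) _).trans
      (L.eq_comp_of_mem hc v.2).superset⟩

theorem exists_cellEdge (hc : c ∈ L.cells d) (e : L.CellEdge d c) :
    ∃ v, L.cellEdge hc e.1 v = e := by
  obtain ⟨a, _, ⟨v, rfl⟩, h⟩ := e
  exact ⟨⟨v, h (L.mem_comp_self _ _)⟩, rfl⟩

theorem exists_cellFace (hc : c ∈ L.cells d) (f : L.CellFace d c) :
    ∃ v, L.cellFace hc f.1 v = f := by
  obtain ⟨k, _, ⟨v, rfl⟩, h⟩ := f
  exact ⟨⟨v, h (L.mem_comp_self _ _)⟩, rfl⟩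

/-- The neighbor of a vertex in the cell. -/
def cellNbr (hc : c ∈ L.cells d) (a : {a : Color // a ≠ d}) (v : c) : c :=
  ⟨L.σ a.1 v.1, L.σ_mem_of_mem_range hc a.2 v.2⟩

theorem cellEdge_nbr (hc : c ∈ L.cells d) (a : {a : Color // a ≠ d}) (v : c) :
    L.cellEdge hc a (L.cellNbr hc a v) = L.cellEdge hc a v := by
  unfold cellEdge
  congr 2
  exact L.comp_σ (Set.mem_singleton a.1) v.1

theorem cellFace_nbr (hc : c ∈ L.cells d) {a k : {a : Color // a ≠ d}} (h : a ≠ k) (v : c) :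
    L.cellFace hc k (L.cellNbr hc a v) = L.cellFace hc k v := by
  unfold cellFace
  congr 2
  refine L.comp_σ ?_ v.1
  simp only [Set.mem_compl_iff, Set.mem_insert_iff, Set.mem_singleton_iff, not_or]
  exact ⟨a.2, fun h' => h (Subtype.ext h')⟩

theorem eq_or_eq_of_cellEdge_eq (hc : c ∈ L.cells d) {a : {a : Color // a ≠ d}} {u v : c}
    (h : L.cellEdge hc a u = L.cellEdge hc a v) : u = v ∨ u = L.cellNbr hc a v := by
  have h1 : L.comp {a.1} u.1 = L.comp {a.1} v.1 := by
    have := eq_of_heq (Sigma.mk.inj h).2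
    exact congrArg Subtype.val this
  have h2 : u.1 ∈ L.comp {a.1} v.1 := h1 ▸ L.mem_comp_self _ _
  rw [comp_singleton] at h2
  exact h2.imp Subtype.ext Subtype.ext

theorem eq_of_forall_cellNbr (hc : c ∈ L.cells d) {x : c → ZMod 2}
    (hx : ∀ a v, x (L.cellNbr hc a v) = x v) (u v : c) : x u = x v := by
  have h := L.eq_of_mem_comp (S := {d}ᶜ) (P := c)
    (f := fun w => if hw : w ∈ c then x ⟨w, hw⟩ else 0)
    (fun a ha w hw => L.σ_mem_of_mem_range hc ha hw)
    (fun a ha w hw => by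
      rw [dif_pos hw, dif_pos (L.σ_mem_of_mem_range hc ha hw)]
      exact hx ⟨a, ha⟩ ⟨w, hw⟩) v.2 (u := u.1) (by
      rw [← L.eq_comp_of_mem hc v.2]; exact u.2)
  simpa using h

theorem card_cellColors (d : Color) : (Fintype.card {a : Color // a ≠ d} : ZMod 2) = 1 := by
  rw [Fintype.card_subtype_compl]
  simp
  rfl

/-- The boundary of a 1-chain. -/
def edgeBoundary (hc : c ∈ L.cells d) : (L.CellEdge d c → ZMod 2) →ₗ[ZMod 2] (c → ZMod 2) where
  toFun z v := ∑ a, z (L.cellEdge hc a v)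
  map_add' x y := by ext v; simp [Finset.sum_add_distrib]
  map_smul' r x := by ext v; simp [Finset.mul_sum]

/-- The boundary of a 2-chain. -/
def faceBoundary (hc : c ∈ L.cells d) :
    (L.CellFace d c → ZMod 2) →ₗ[ZMod 2] (L.CellEdge d c → ZMod 2) where
  -- The two faces along an edge are those of the other two labels. Either end gives the same faces,
  -- so the chosen end is immaterial.
  toFun g e := ∑ k ∈ Finset.univ.erase e.1, g (L.cellFace hc k (L.exists_cellEdge hc e).choose)
  map_add' x y := by ext v; simp [Finset.sum_add_distrib]
  map_smul' r x := by
    ext v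
    simp only [Pi.smul_apply, smul_eq_mul, Finset.mul_sum, RingHom.id_apply]

theorem faceBoundary_apply (hc : c ∈ L.cells d) (g : L.CellFace d c → ZMod 2)
    (a : {a : Color // a ≠ d}) (v : c) :
    L.faceBoundary hc g (L.cellEdge hc a v) =
      ∑ k ∈ Finset.univ.erase a, g (L.cellFace hc k v) := by
  change ∑ k ∈ Finset.univ.erase a,
    g (L.cellFace hc k (L.exists_cellEdge hc (L.cellEdge hc a v)).choose) = _
  refine Finset.sum_congr rfl fun k hk => ?_
  have hk' : a ≠ k := (Finset.ne_of_mem_erase hk).symm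
  have h := (L.exists_cellEdge hc (L.cellEdge hc a v)).choose_spec
  rcases L.eq_or_eq_of_cellEdge_eq hc h with h | h
  · rw [h]
  · rw [h]
    exact congrArg g (L.cellFace_nbr hc hk' v)

theorem faceBoundary_apply' (hc : c ∈ L.cells d) (g : L.CellFace d c → ZMod 2)
    (a : {a : Color // a ≠ d}) (v : c) :
    L.faceBoundary hc g (L.cellEdge hc a v) =
      (∑ k, g (L.cellFace hc k v)) - g (L.cellFace hc a v) := by
  rw [faceBoundary_apply, Finset.sum_erase_eq_sub (Finset.mem_univ a)]

/-- Each of the three edges at a vertex gets the total of the three face labels minus its own; three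
totals minus one total is zero mod 2. -/
theorem edgeBoundary_faceBoundary (hc : c ∈ L.cells d) (g : L.CellFace d c → ZMod 2) :
    L.edgeBoundary hc (L.faceBoundary hc g) = 0 := by
  ext v
  change ∑ a, L.faceBoundary hc g (L.cellEdge hc a v) = 0
  simp only [faceBoundary_apply', Finset.sum_sub_distrib, Finset.sum_const, Finset.card_univ,
    nsmul_eq_mul, card_cellColors, one_mul, sub_self]

/-- In the kernel the three face labels at a vertex coincide. Crossing an edge preserves two of
those faces, so the labels are constant on the connected cell. -/
theorem finrank_ker_faceBoundary_le (hc : c ∈ L.cells d) :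
    Module.finrank (ZMod 2) (LinearMap.ker (L.faceBoundary hc)) ≤ 1 := by
  obtain ⟨v₀, hv₀⟩ := L.nonempty_of_mem_range hc
  obtain ⟨k₀⟩ : Nonempty {a : Color // a ≠ d} := by
    obtain ⟨a, ha⟩ := exists_ne d
    exact ⟨⟨a, ha⟩⟩
  let ev : LinearMap.ker (L.faceBoundary hc) →ₗ[ZMod 2] ZMod 2 :=
    LinearMap.proj (L.cellFace hc k₀ ⟨v₀, hv₀⟩) ∘ₗ Submodule.subtype _
  have hev : Function.Injective ev := by
    rw [← LinearMap.ker_eq_bot, LinearMap.ker_eq_bot']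
    rintro ⟨g, hg⟩ hg0
    replace hg0 : g (L.cellFace hc k₀ ⟨v₀, hv₀⟩) = 0 := hg0
    have h1 : ∀ k l v, g (L.cellFace hc k v) = g (L.cellFace hc l v) := by
      intro k l v
      have h := fun k => (L.faceBoundary_apply' hc g k v).symm.trans
        (congrFun (LinearMap.mem_ker.1 hg) (L.cellEdge hc k v))
      rw [← sub_eq_zero.1 (h k), ← sub_eq_zero.1 (h l)]
    have h2 := L.eq_of_forall_cellNbr hc (x := fun v => g (L.cellFace hc k₀ v)) fun a v => by
      have hl : ∀ a b : Color, ∃ l, l ≠ b ∧ l ≠ a := by decide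
      obtain ⟨l, hl, hla⟩ := hl a.1 d
      rw [h1 k₀ ⟨l, hl⟩, L.cellFace_nbr hc (fun h => hla (congrArg Subtype.val h).symm), h1]
    ext f
    obtain ⟨v, hv⟩ := L.exists_cellFace hc f
    rw [← hv]
    change g _ = 0
    rw [h1 _ k₀, h2 v ⟨v₀, hv₀⟩, hg0]
  simpa using LinearMap.finrank_le_finrank_of_injective hev

variable [Fintype V]

/-- The rank equals that of the transpose, the coboundary, whose kernel consists of functions
constant along edges, hence constant on the connected cell. -/
theorem card_le_finrank_range_edgeBoundary (hc : c ∈ L.cells d) :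
    Fintype.card c ≤ Module.finrank (ZMod 2) (LinearMap.range (L.edgeBoundary hc)) + 1 := by
  obtain ⟨v₀, hv₀⟩ := L.nonempty_of_mem_range hc
  let m := LinearMap.toMatrix' (L.edgeBoundary hc)
  have hm : m.rank = Module.finrank (ZMod 2) (LinearMap.range (L.edgeBoundary hc)) := by
    rw [Matrix.rank, ← Matrix.toLin'_apply', Matrix.toLin'_toMatrix']
  rw [← hm, ← Matrix.rank_transpose, Matrix.rank]
  have h1 := LinearMap.finrank_range_add_finrank_ker m.transpose.mulVecLin
  rw [Module.finrank_pi] at h1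
  have h2 : Module.finrank (ZMod 2) (LinearMap.ker m.transpose.mulVecLin) ≤ 1 := by
    let ev : LinearMap.ker m.transpose.mulVecLin →ₗ[ZMod 2] ZMod 2 :=
      LinearMap.proj ⟨v₀, hv₀⟩ ∘ₗ Submodule.subtype _
    have hev : Function.Injective ev := by
      rw [← LinearMap.ker_eq_bot, LinearMap.ker_eq_bot']
      rintro ⟨x, hx⟩ hx0
      replace hx0 : x ⟨v₀, hv₀⟩ = 0 := hx0
      have h3 := L.eq_of_forall_cellNbr hc (x := x) fun a v => by
        have h := congrFun (LinearMap.mem_ker.1 hx) (L.cellEdge hc a v)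
        have hmv : ∀ u, m u (L.cellEdge hc a v) =
            if u = v ∨ u = L.cellNbr hc a v then 1 else 0 := by
          intro u
          refine (LinearMap.toMatrix'_apply _ _ _).trans ?_
          change ∑ b, (Pi.single (L.cellEdge hc a v) (1 : ZMod 2) : L.CellEdge d c → ZMod 2)
            (L.cellEdge hc b u) = _
          rw [Finset.sum_eq_single a]
          · by_cases hu : u = v ∨ u = L.cellNbr hc a v
            · rw [if_pos hu]
              rcases hu with rfl | rfl
              · simp
              · simp [cellEdge_nbr]
            · rw [if_neg hu, Pi.single_apply, if_neg]
              exact fun h => hu (L.eq_or_eq_of_cellEdge_eq hc h)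
          · intro b _ hb
            rw [Pi.single_apply, if_neg]
            exact fun h => hb (congrArg Sigma.fst h)
          · simp
        rw [Matrix.mulVecLin_apply, Matrix.mulVec, dotProduct] at h
        simp only [Matrix.transpose_apply, hmv, ite_mul, one_mul, zero_mul] at h
        rw [← Finset.sum_filter, show Finset.univ.filter
          (fun u => u = v ∨ u = L.cellNbr hc a v) = {v, L.cellNbr hc a v} by ext u; simp,
          Finset.sum_pair (fun h => L.σ_ne a.1 v.1 (congrArg Subtype.val h).symm)] at h
        exact (CharTwo.add_eq_zero.1 h).symm
      ext v
      change x v = 0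
      rw [h3 v ⟨v₀, hv₀⟩, hx0]
    simpa using LinearMap.finrank_le_finrank_of_injective hev
  omega

/-- The first homology of the boundary of a cell vanishes. -/
theorem exists_faceBoundary_eq (hL : L.IsCellulation) (hc : c ∈ L.cells d)
    {z : L.CellEdge d c → ZMod 2} (hz : L.edgeBoundary hc z = 0) :
    ∃ g, L.faceBoundary hc g = z := by
  have hle : LinearMap.range (L.faceBoundary hc) ≤ LinearMap.ker (L.edgeBoundary hc) := by
    rintro _ ⟨g, rfl⟩
    exact L.edgeBoundary_faceBoundary hc g
  have h1 := LinearMap.finrank_range_add_finrank_ker (L.faceBoundary hc)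
  have h2 := LinearMap.finrank_range_add_finrank_ker (L.edgeBoundary hc)
  have h3 := L.finrank_ker_faceBoundary_le hc
  have h4 := L.card_le_finrank_range_edgeBoundary hc
  rw [Module.finrank_pi] at h1 h2
  have hE : (Fintype.card (L.CellEdge d c) : ℤ) =
      ∑ b ∈ Finset.univ.erase d, ({e ∈ L.edges b | e ⊆ c}.ncard : ℤ) := by
    rw [Fintype.card_sigma, Nat.cast_sum,
      Finset.sum_subtype (p := fun a => a ≠ d) _ (by simp)]
    refine Finset.sum_congr rfl fun a _ => ?_
    rw [← Nat.card_eq_fintype_card]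
    rfl
  have hF : (Fintype.card (L.CellFace d c) : ℤ) =
      ∑ b ∈ Finset.univ.erase d, ({f ∈ L.faces d b | f ⊆ c}.ncard : ℤ) := by
    rw [Fintype.card_sigma, Nat.cast_sum,
      Finset.sum_subtype (p := fun a => a ≠ d) _ (by simp)]
    refine Finset.sum_congr rfl fun a _ => ?_
    rw [← Nat.card_eq_fintype_card]
    rfl
  have hV : (Fintype.card c : ℤ) = c.ncard := by
    rw [← Nat.card_eq_fintype_card]
    rfl
  have hEuler := hL d c hc
  rw [← hE, ← hF, ← hV] at hEuler
  -- With V, E, F the numbers of vertices, edges and faces, cycles have dimension at most E − V + 1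
  -- = F − 1 by V − E + F = 2, and boundaries have dimension at least F − 1.
  have heq := Submodule.eq_of_le_of_finrank_le hle (by omega)
  have : z ∈ LinearMap.range (L.faceBoundary hc) := by rw [heq]; exact hz
  exact this

/-- Edge labels that sum to zero at every vertex of a cell come from face labels. -/
theorem exists_face_labels (hL : L.IsCellulation) (hc : c ∈ L.cells d) {z : Color → V → ZMod 2}
    (hz : ∀ a, a ≠ d → ∀ v ∈ c, z a (L.σ a v) = z a v)
    (h0 : ∀ v ∈ c, ∑ a ∈ Finset.univ.erase d, z a v = 0) :
    ∃ g : Color → V → ZMod 2,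
      (∀ k, k ≠ d → ∀ l, l ≠ d → l ≠ k → ∀ v ∈ c, g k (L.σ l v) = g k v) ∧
      ∀ a, a ≠ d → ∀ v ∈ c, z a v = ∑ k ∈ (Finset.univ.erase d).erase a, g k v := by
  let z' : L.CellEdge d c → ZMod 2 := fun e => z e.1.1 (L.exists_cellEdge hc e).choose.1
  have hz' : ∀ a v, z' (L.cellEdge hc a v) = z a.1 v.1 := by
    intro a v
    have h := (L.exists_cellEdge hc (L.cellEdge hc a v)).choose_spec
    change z a.1 (L.exists_cellEdge hc (L.cellEdge hc a v)).choose.1 = _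
    rcases L.eq_or_eq_of_cellEdge_eq hc h with h | h
    · rw [h]
    · rw [h]
      exact hz _ a.2 _ v.2
  obtain ⟨g, hg⟩ := L.exists_faceBoundary_eq hL hc (z := z') (by
    ext v
    change ∑ a, z' (L.cellEdge hc a v) = 0
    simp only [hz']
    rw [← h0 v.1 v.2, Finset.sum_subtype (p := fun a => a ≠ d) _ (by simp)])
  refine ⟨fun k v => if h : k ≠ d ∧ v ∈ c then g (L.cellFace hc ⟨k, h.1⟩ ⟨v, h.2⟩) else 0,
    fun k hk l hl hlk v hv => ?_, fun a ha v hv => ?_⟩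
  · have hv' := L.σ_mem_of_mem_range hc hl hv
    simp only [hk, hv, hv', ne_eq, not_false_eq_true, and_self, dite_true]
    exact congrArg g (L.cellFace_nbr hc (a := ⟨l, hl⟩) (k := ⟨k, hk⟩)
      (fun h => hlk (congrArg Subtype.val h)) ⟨v, hv⟩)
  · rw [← hz' ⟨a, ha⟩ ⟨v, hv⟩, ← hg, faceBoundary_apply, Finset.erase_right_comm]
    have h1 : (Finset.univ.erase a).erase d =
        (Finset.univ.erase (⟨a, ha⟩ : {a : Color // a ≠ d})).map (Function.Embedding.subtype _) := by
      ext k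
      simp [and_comm]
    rw [h1, Finset.sum_map]
    refine Finset.sum_congr rfl fun k _ => ?_
    simp [k.2, hv]

end Homology

end ColorGraph

/-! ### Unfolding the color code into three toric codes -/

theorem sigma_image_indicator {ι : Type*} {Q : ι → Type*} (i j : ι) (t : Set (Q i)) (q : Q j) :
    ((Sigma.mk i '' t).indicator 1 (⟨j, q⟩ : Σ i, Q i) : ZMod 2) =
      if h : j = i then (if h ▸ q ∈ t then 1 else 0) else 0 := by
  by_cases h : j = i
  · subst h
    simp [Set.indicator]
  · rw [dif_neg h, Set.indicator_of_notMem]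
    rintro ⟨p, _, hp⟩
    exact h (congrArg Sigma.fst hp).symm

/-- A vector is in a space if it is constant on blocks whose indicators are in the space. -/
theorem mem_of_indicator_fibers_mem {Q T : Type*} [Fintype Q] (F : Q → T)
    (P : Submodule (ZMod 2) (Q → ZMod 2)) (y : Q → ZMod 2) (hy : ∀ q q', F q = F q' → y q = y q')
    (hP : ∀ q, y q ≠ 0 → {q' | F q' = F q}.indicator 1 ∈ P) : y ∈ P := by
  have h : y = ∑ t ∈ Finset.univ.image F,
      if h : ∃ q, F q = t then y h.choose • {q' | F q' = t}.indicator 1 else 0 := by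
    ext q
    rw [Finset.sum_apply, Finset.sum_eq_single (F q)]
    · have hex : ∃ q', F q' = F q := ⟨q, rfl⟩
      rw [dif_pos hex]
      simp [hy _ _ hex.choose_spec]
    · intro t _ ht
      split_ifs with hex
      · simp [ht.symm]
      · rfl
    · simp
  rw [h]
  refine sum_mem fun t _ => ?_
  split_ifs with hex
  · by_cases h0 : y hex.choose = 0
    · rw [h0, zero_smul]
      exact zero_mem _
    · have := hP _ h0
      rw [hex.choose_spec] at this
      exact Submodule.smul_mem _ _ this
  · exact zero_mem _

namespace ColorGraph

variable {V : Type*} (L : ColorGraph V) {a b d : Color} {R : Set V}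

theorem IsCut.σ_mem {L : ColorGraph V} (hR : L.IsCut d R) (ha : a ≠ d) {v : V} (hv : v ∈ R) :
    L.σ a v ∈ R := by
  by_contra h
  exact ha (hR a v hv h)

theorem IsCut.comp_subset {L : ColorGraph V} (hR : L.IsCut d R) {S : Set Color} (hS : d ∉ S)
    {v : V} (hv : v ∈ R) : L.comp S v ⊆ R :=
  L.comp_subset (fun _ ha _ hu => hR.σ_mem (fun h => hS (h ▸ ha)) hu) hv

theorem cellAround_singleton (d : Color) (v : V) : L.cellAround d {v} = L.comp {d}ᶜ v := by
  simp [cellAround]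

theorem cellAround_eq {e : Set V} (ha : a ≠ d) (he : e ∈ L.edges a) {v : V} (hv : v ∈ e) :
    L.cellAround d e = L.comp {d}ᶜ v := by
  have h : ∀ u ∈ e, L.comp {d}ᶜ u = L.comp {d}ᶜ v := fun u hu =>
    L.comp_eq_of_mem (L.comp_mono (Set.singleton_subset_iff.2 ha) v (L.eq_comp_of_mem he hv ▸ hu))
  refine subset_antisymm (Set.iUnion₂_subset fun u hu => (h u hu).subset) ?_
  exact Set.subset_biUnion_of_mem (u := fun v => L.comp {d}ᶜ v) hv

theorem odd_ncard_inter_edge (c : Set V) (a : Color) (v : V) :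
    (if Odd (c ∩ L.comp {a} v).ncard then 1 else 0 : ZMod 2) =
      (if v ∈ c then 1 else 0) + if L.σ a v ∈ c then 1 else 0 := by
  rw [comp_singleton]
  by_cases h1 : v ∈ c <;> by_cases h2 : L.σ a v ∈ c
  · rw [Set.inter_eq_right.2 (Set.insert_subset h1 (Set.singleton_subset_iff.2 h2)),
      Set.ncard_pair (L.σ_ne a v).symm]
    simp [h1, h2, CharTwo.add_self_eq_zero]
  · rw [Set.inter_insert_of_mem h1, Set.inter_singleton_eq_empty.2 h2]
    simp [h1, h2]
  · rw [Set.inter_insert_of_notMem h1, Set.inter_eq_right.2 (Set.singleton_subset_iff.2 h2)]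
    simp [h1, h2]
  · rw [Set.inter_insert_of_notMem h1, Set.inter_singleton_eq_empty.2 h2]
    simp [h1, h2]

section Unfolding

variable (R) (col : Fin 3 → Color)

/-- The qubits of the three toric codes. -/
abbrev ToricQubit : Type _ := Σ i : Fin 3, L.retained R (col i)

variable {R col}

/-- The edge of the `i`-th color at a retained vertex. -/
def retainedEdge (hR : L.IsCut d R) (hd : ∀ i, col i ≠ d) (i : Fin 3) (v : R) :
    L.ToricQubit R col :=
  ⟨i, ⟨L.comp {col i} v.1, ⟨v.1, rfl⟩⟩, hR.comp_subset (fun h => hd i h.symm) v.2⟩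

/-- The neighbor of a retained vertex along the edge of the `i`-th color. -/
def retainedNbr (hR : L.IsCut d R) (hd : ∀ i, col i ≠ d) (i : Fin 3) (v : R) : R :=
  ⟨L.σ (col i) v.1, hR.σ_mem (hd i) v.2⟩

theorem eq_retainedEdge (hR : L.IsCut d R) (hd : ∀ i, col i ≠ d) (q : L.ToricQubit R col) {v : R}
    (hv : v.1 ∈ q.2.1.1) : q = L.retainedEdge hR hd q.1 v := by
  obtain ⟨i, ⟨⟨e, he⟩, hr⟩⟩ := q
  obtain rfl := L.eq_comp_of_mem he hv
  rfl

theorem exists_mem_toricQubit (q : L.ToricQubit R col) : ∃ v : R, v.1 ∈ q.2.1.1 := by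
  obtain ⟨v, hv⟩ := L.nonempty_of_mem_range q.2.1.2
  exact ⟨⟨v, q.2.2 hv⟩, hv⟩

theorem mem_retainedEdge (hR : L.IsCut d R) (hd : ∀ i, col i ≠ d) (i : Fin 3) (v : R) :
    v.1 ∈ (L.retainedEdge hR hd i v).2.1.1 := L.mem_comp_self _ _

variable [Fintype V]

theorem sum_toricQubit (hR : L.IsCut d R) (hd : ∀ i, col i ≠ d) (f : L.ToricQubit R col → ZMod 2)
    (v : R) : ∑ q, (if v.1 ∈ q.2.1.1 then f q else 0) = ∑ i, f (L.retainedEdge hR hd i v) := by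
  rw [Fintype.sum_sigma]
  refine Finset.sum_congr rfl fun i _ => ?_
  refine (Finset.sum_eq_single (L.retainedEdge hR hd i v).2 (fun e _ he => if_neg fun h => ?_)
    (fun h => absurd (Finset.mem_univ _) h)).trans (if_pos (L.mem_retainedEdge hR hd i v))
  have := L.eq_retainedEdge hR hd ⟨i, e⟩ h
  exact he (eq_of_heq (Sigma.mk.inj this).2)

variable (R col d)

/-- The linear map of the unfolding: from vertices to their edges, and to one vertex in each cell. -/
def unfoldMap : (R → ZMod 2) →ₗ[ZMod 2]
    (L.ToricQubit R col ⊕ (Σ _ : Set V, Fin 1) → ZMod 2) where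
  toFun x := Sum.elim (fun q => ∑ v : R, if v.1 ∈ q.2.1.1 then x v else 0)
    -- The reference bit restores the constant on each cell that edge sums lose. Blocks range over
    -- all sets of vertices, and those that are not retained cells get 0.
    fun s => if h : ∃ v : R, L.comp {d}ᶜ v.1 = s.1 then x h.choose else 0
  map_add' x y := by
    ext (q | s)
    · simp only [Sum.elim_inl, Pi.add_apply, ← Finset.sum_add_distrib]
      refine Finset.sum_congr rfl fun v _ => ?_
      split_ifs <;> simp
    · simp only [Sum.elim_inr, Pi.add_apply]
      split_ifs <;> simp
  map_smul' r x := by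
    ext (q | s)
    · simp only [Sum.elim_inl, Pi.smul_apply, smul_eq_mul, RingHom.id_apply, Finset.mul_sum]
      refine Finset.sum_congr rfl fun v _ => ?_
      split_ifs <;> simp
    · simp only [Sum.elim_inr, Pi.smul_apply, smul_eq_mul, RingHom.id_apply]
      split_ifs <;> simp

variable {R col d}

theorem unfoldMap_inl (x : R → ZMod 2) (q : L.ToricQubit R col) :
    L.unfoldMap d R col x (Sum.inl q) = ∑ v : R, if v.1 ∈ q.2.1.1 then x v else 0 := rfl

theorem unfoldMap_inr (x : R → ZMod 2) (s : Σ _ : Set V, Fin 1) :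
    L.unfoldMap d R col x (Sum.inr s) =
      if h : ∃ v : R, L.comp {d}ᶜ v.1 = s.1 then x h.choose else 0 := rfl

theorem unfoldMap_edge (hR : L.IsCut d R) (hd : ∀ i, col i ≠ d) (x : R → ZMod 2) (i : Fin 3)
    (v : R) : L.unfoldMap d R col x (Sum.inl (L.retainedEdge hR hd i v)) =
      x v + x (L.retainedNbr hR hd i v) := by
  rw [unfoldMap_inl, ← Finset.sum_filter, show Finset.univ.filter
    (fun u : R => u.1 ∈ (L.retainedEdge hR hd i v).2.1.1) = {v, L.retainedNbr hR hd i v} by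
      ext u
      simp [retainedEdge, retainedNbr, comp_singleton, Subtype.ext_iff],
    Finset.sum_pair (fun h => L.σ_ne (col i) v.1 (congrArg Subtype.val h).symm)]

omit [Fintype V] in
theorem eq_of_forall_retainedNbr (hR : L.IsCut d R) (hd : ∀ i, col i ≠ d)
    (hs : ∀ a, a ≠ d → ∃ i, col i = a) {x : R → ZMod 2}
    (hx : ∀ i v, x (L.retainedNbr hR hd i v) = x v) {u v : R} (h : u.1 ∈ L.comp {d}ᶜ v.1) :
    x u = x v := by
  have h := L.eq_of_mem_comp (S := {d}ᶜ) (P := R)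
    (f := fun w => if hw : w ∈ R then x ⟨w, hw⟩ else 0)
    (fun a ha w hw => hR.σ_mem ha hw)
    (fun a ha w hw => by
      rw [dif_pos hw, dif_pos (hR.σ_mem ha hw)]
      obtain ⟨i, rfl⟩ := hs a ha
      exact hx i ⟨w, hw⟩) v.2 h
  simpa using h

theorem unfoldMap_injective (hR : L.IsCut d R) (hd : ∀ i, col i ≠ d)
    (hs : ∀ a, a ≠ d → ∃ i, col i = a) : Function.Injective (L.unfoldMap d R col) := by
  rw [← LinearMap.ker_eq_bot, LinearMap.ker_eq_bot']
  intro x hx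
  have h1 : ∀ i v, x (L.retainedNbr hR hd i v) = x v := fun i v => by
    have := congrFun hx (Sum.inl (L.retainedEdge hR hd i v))
    rw [unfoldMap_edge] at this
    exact (CharTwo.add_eq_zero.1 this).symm
  ext v
  have h2 := congrFun hx (Sum.inr ⟨L.comp {d}ᶜ v.1, 0⟩)
  have hex : ∃ u : R, L.comp {d}ᶜ u.1 = L.comp {d}ᶜ v.1 := ⟨v, rfl⟩
  rw [unfoldMap_inr, dif_pos hex] at h2
  rw [L.eq_of_forall_retainedNbr hR hd hs h1 (u := v) (v := hex.choose)
    (by rw [hex.choose_spec]; exact L.mem_comp_self _ _)]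
  exact h2

theorem unfoldMap_local (hd : ∀ i, col i ≠ d) (x : R → ZMod 2)
    (w : L.ToricQubit R col ⊕ (Σ _ : Set V, Fin 1))
    (h : ∀ v : R, L.cellAround d {v.1} =
      Sum.elim (fun q : L.ToricQubit R col => L.cellAround d q.2.1.1) Sigma.fst w → x v = 0) :
    L.unfoldMap d R col x w = 0 := by
  rcases w with q | s
  · rw [unfoldMap_inl]
    refine Finset.sum_eq_zero fun v _ => ?_
    split_ifs with hv
    · refine h v ?_
      rw [cellAround_singleton, Sum.elim_inl, L.cellAround_eq (hd q.1) q.2.1.2 hv]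
    · rfl
  · rw [unfoldMap_inr]
    split_ifs with hex
    · refine h _ ?_
      rw [cellAround_singleton, Sum.elim_inr]
      exact hex.choose_spec
    · rfl

omit [Fintype V] in
theorem indicator_val_preimage (c : Set V) (v : R) :
    ((Subtype.val ⁻¹' c : Set R).indicator 1 v : ZMod 2) = if v.1 ∈ c then 1 else 0 := by
  simp [Set.indicator]

theorem unfoldMap_edge_cell (hR : L.IsCut d R) (hd : ∀ i, col i ≠ d) {c : Set V}
    (hc : c ∈ L.cells a) {i : Fin 3} (hi : col i ≠ a) (v : R) :
    L.unfoldMap d R col ((Subtype.val ⁻¹' c : Set R).indicator 1)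
      (Sum.inl (L.retainedEdge hR hd i v)) = 0 := by
  rw [unfoldMap_edge, indicator_val_preimage, indicator_val_preimage]
  have : v.1 ∈ c ↔ (L.retainedNbr hR hd i v).1 ∈ c := by
    refine ⟨fun h => L.σ_mem_of_mem_range hc hi h, fun h => ?_⟩
    have := L.σ_mem_of_mem_range hc hi h
    rwa [retainedNbr, L.σ_σ] at this
  rw [if_congr this rfl rfl, CharTwo.add_self_eq_zero]

theorem unfoldMap_cell_self (hR : L.IsCut d R) (hd : ∀ i, col i ≠ d) {c : Set V}
    (hc : c ∈ L.cells d) :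
    (fun q => L.unfoldMap d R col ((Subtype.val ⁻¹' c : Set R).indicator 1) (Sum.inl q)) = 0 := by
  ext q
  obtain ⟨v, hv⟩ := L.exists_mem_toricQubit q
  rw [L.eq_retainedEdge hR hd q hv, L.unfoldMap_edge_cell hR hd hc (hd q.1)]
  rfl

theorem unfoldMap_cell (hR : L.IsCut d R) (hd : ∀ i, col i ≠ d) (hcol : Function.Injective col)
    (i : Fin 3) {c : Set V} (hc : c ∈ L.cells (col i)) :
    (fun q => L.unfoldMap d R col ((Subtype.val ⁻¹' c : Set R).indicator 1) (Sum.inl q)) =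
      (Sigma.mk i '' {e : L.retained R (col i) |
        Odd ((L.shrink (col i)).inc ⟨c, hc⟩ e.1)}).indicator 1 := by
  ext ⟨j, e⟩
  obtain ⟨v, hv⟩ := L.exists_mem_toricQubit ⟨j, e⟩
  have h1 := L.eq_retainedEdge hR hd ⟨j, e⟩ hv
  rw [sigma_image_indicator, h1]
  by_cases hj : j = i
  · subst hj
    rw [dif_pos rfl, unfoldMap_edge, indicator_val_preimage, indicator_val_preimage]
    convert (L.odd_ncard_inter_edge c (col j) v.1).symm
    · rfl
    · rw [← L.eq_comp_of_mem e.1.2 hv]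
      rfl
  · rw [dif_neg hj]
    exact L.unfoldMap_edge_cell hR hd hc (fun h => hj (hcol h)) v

/-- Each retained vertex of the face lies on exactly one edge of color `col i`, and that edge lies
in the face and in `R`; so summing the edge sums counts each vertex once. -/
theorem unfoldMap_face (hR : L.IsCut d R) (hd : ∀ i, col i ≠ d) (i : Fin 3) (b : Color)
    {f : Set V} (hf : f ∈ Set.range (L.comp {col i, b})) (x : R → ZMod 2) :
    (Subtype.val ⁻¹' f : Set R).indicator 1 ⬝ᵥ x =
      (Sigma.mk i '' {e : L.retained R (col i) | e.1.1 ⊆ f}).indicator 1 ⬝ᵥ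
        fun q => L.unfoldMap d R col x (Sum.inl q) := by
  simp only [unfoldMap_inl, dotProduct, Finset.mul_sum]
  rw [Finset.sum_comm]
  refine Finset.sum_congr rfl fun v _ => ?_
  have h := L.sum_toricQubit hR hd (fun q => (Sigma.mk i '' {e : L.retained R (col i) |
    e.1.1 ⊆ f}).indicator 1 q * x v) v
  simp only [mul_ite, mul_zero]
  refine Eq.trans ?_ h.symm
  rw [Finset.sum_eq_single i]
  · congr 1
    rw [indicator_val_preimage, retainedEdge, sigma_image_indicator, dif_pos rfl]
    refine if_congr ⟨fun hv => ?_, fun hv => hv (L.mem_comp_self _ _)⟩ rfl rfl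
    change L.comp {col i} v.1 ⊆ f
    rw [L.eq_comp_of_mem hf hv]
    exact L.comp_mono (by simp) _
  · intro j _ hj
    rw [retainedEdge, sigma_image_indicator, dif_neg hj, zero_mul]
  · simp

omit [Fintype V] in
theorem face_mem_tensor_zs (hR : L.IsCut d R) (hd : ∀ i, col i ≠ d) {i : Fin 3} {b : Color}
    (hb : b ≠ col i) {f : Set V} (hf : f ∈ Set.range (L.comp {col i, b})) (hfR : (f ∩ R).Nonempty) :
    Sigma.mk i '' {e : L.retained R (col i) | e.1.1 ⊆ f} ∈
      (CSSCode.tensor fun i => L.roughToric R (col i)).zs := by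
  refine ⟨i, _, ⟨⟨(b, f), hb, hf⟩, ?_, rfl⟩, rfl⟩
  obtain ⟨v, hvf, hvR⟩ := hfR
  refine ⟨(L.retainedEdge hR hd i ⟨v, hvR⟩).2.1, ?_, (L.retainedEdge hR hd i ⟨v, hvR⟩).2.2⟩
  change L.comp {col i} v ⊆ f
  rw [L.eq_comp_of_mem hf hvf]
  exact L.comp_mono (by simp) _

/-- Of the two edge colors of a face at least one differs from `d`, which assigns the face to a
toric code. -/
theorem exists_colors_of_face (a b d : Color) (h : a ≠ b) :
    ∃ x y : Color, x ≠ d ∧ y ≠ x ∧ ({a, b}ᶜ : Set Color) = {x, y} := by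
  have key : ∀ a b d : Color, a ≠ b → ∃ x y : Color, x ≠ d ∧ y ≠ x ∧
      ∀ t, ¬ (t = a ∨ t = b) ↔ (t = x ∨ t = y) := by decide
  obtain ⟨x, y, h1, h2, h3⟩ := key a b d h
  exact ⟨x, y, h1, h2, Set.ext h3⟩

theorem exists_compl_colors (x y : Color) (h : y ≠ x) :
    ∃ a b : Color, a ≠ b ∧ ({a, b}ᶜ : Set Color) = {x, y} := by
  have key : ∀ x y : Color, y ≠ x → ∃ a b : Color, a ≠ b ∧
      ∀ t, ¬ (t = a ∨ t = b) ↔ (t = x ∨ t = y) := by decide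
  obtain ⟨a, b, h1, h3⟩ := key x y h
  exact ⟨a, b, h1, Set.ext h3⟩

theorem exists_other_color (d k x : Color) (hk : k ≠ d) (hx : x ≠ d) (hxk : x ≠ k) :
    ∃ y, y ≠ x ∧ ({d, k}ᶜ : Set Color) = {x, y} := by
  have key : ∀ d k x : Color, k ≠ d → x ≠ d → x ≠ k → ∃ y, y ≠ x ∧
      ∀ t, ¬ (t = d ∨ t = k) ↔ (t = x ∨ t = y) := by decide
  obtain ⟨y, h1, h3⟩ := key d k x hk hx hxk
  exact ⟨y, h1, Set.ext h3⟩

/-- A label on the (d,k)-faces is spread over their edges of both colors. Within one edge color it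
is constant around each face, and the edges of that color around a face support a generator of one
toric code. -/
theorem face_labels_mem_zSpace (hR : L.IsCut d R) (hd : ∀ i, col i ≠ d) {k : Color} (hk : k ≠ d)
    {g : V → ZMod 2} (hg : ∀ l, l ≠ d → l ≠ k → ∀ v ∈ R, g (L.σ l v) = g v) :
    (fun q : L.ToricQubit R col => if col q.1 ≠ k then g (L.exists_mem_toricQubit q).choose.1 else 0)
      ∈ (CSSCode.tensor fun i => L.roughToric R (col i)).zSpace := by
  have hcl : ∀ l ∈ ({d, k}ᶜ : Set Color), ∀ u ∈ R, L.σ l u ∈ R := fun l hl u hu =>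
    hR.σ_mem (fun h => hl (Or.inl h)) hu
  refine mem_of_indicator_fibers_mem
    (fun q => (q.1, L.comp {d, k}ᶜ (L.exists_mem_toricQubit q).choose.1)) _ _ ?_ ?_
  · intro q q' h
    obtain ⟨h1, h2⟩ := Prod.mk.inj h
    simp only [h1]
    congr 1
    refine L.eq_of_mem_comp (S := {d, k}ᶜ) (P := R) hcl
      (fun l hl u hu => hg l (fun h => hl (Or.inl h)) (fun h => hl (Or.inr h)) u hu)
      (L.exists_mem_toricQubit q').choose.2 ?_
    rw [← h2]
    exact L.mem_comp_self _ _
  · intro q hq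
    have hqk : col q.1 ≠ k := by
      intro h
      simp [h] at hq
    obtain ⟨y, hy, hcompl⟩ := exists_other_color d k (col q.1) hk (hd _) hqk
    have hmem := CSSCode.indicator_mem_zSpace (L.face_mem_tensor_zs (col := col) hR hd hy
      (f := L.comp {d, k}ᶜ (L.exists_mem_toricQubit q).choose.1)
      (by rw [hcompl]; exact ⟨_, rfl⟩)
      ⟨_, L.mem_comp_self _ _, (L.exists_mem_toricQubit q).choose.2⟩)
    convert hmem using 2
    ext ⟨j, e⟩
    have hv := (L.exists_mem_toricQubit ⟨j, e⟩).choose_spec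
    constructor
    · intro h
      obtain ⟨h1, h2⟩ := Prod.mk.inj h
      obtain rfl : j = q.1 := h1
      refine ⟨e, ?_, rfl⟩
      change e.1.1 ⊆ _
      rw [L.eq_comp_of_mem e.1.2 hv, ← h2]
      exact L.comp_mono (by rw [hcompl]; simp) _
    · rintro ⟨e', he', h⟩
      obtain ⟨rfl, h2⟩ := Sigma.mk.inj h
      obtain rfl := eq_of_heq h2
      exact Prod.ext rfl (L.comp_eq_of_mem (he' hv))

/-- Vanishing on the image of a single vertex says that the edge labels there sum to zero, so `b` is
a cycle on every retained d-cell. It bounds because the cell is a sphere, and the face labels are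
then treated one color at a time. -/
theorem mem_zSpace_of_dotProduct_unfoldMap (hL : L.IsCellulation) (hR : L.IsCut d R)
    (hd : ∀ i, col i ≠ d) (hcol : Function.Injective col) (hs : ∀ a, a ≠ d → ∃ i, col i = a)
    (b : L.ToricQubit R col ⊕ (Σ _ : Set V, Fin 1) → ZMod 2)
    (hb : ∀ x, b ⬝ᵥ L.unfoldMap d R col x = 0) (hbS : ∀ x s, b (Sum.inr s) *
      L.unfoldMap d R col x (Sum.inr s) = 0) :
    (fun q => b (Sum.inl q)) ∈ (CSSCode.tensor fun i => L.roughToric R (col i)).zSpace := by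
  let z : Color → V → ZMod 2 := fun a v => ∑ i, if h : col i = a ∧ v ∈ R then
    b (Sum.inl (L.retainedEdge hR hd i ⟨v, h.2⟩)) else 0
  have hz : ∀ i (v : R), z (col i) v.1 = b (Sum.inl (L.retainedEdge hR hd i v)) := by
    intro i v
    refine (Finset.sum_eq_single i ?_ (by simp)).trans (dif_pos ⟨rfl, v.2⟩)
    exact fun j _ hj => dif_neg fun h => hj (hcol h.1)
  have hzσ : ∀ a, a ≠ d → ∀ v ∈ R, z a (L.σ a v) = z a v := by
    intro a ha v hv
    obtain ⟨i, rfl⟩ := hs a ha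
    refine (hz i (L.retainedNbr hR hd i ⟨v, hv⟩)).trans (Eq.trans ?_ (hz i ⟨v, hv⟩).symm)
    congr 2
    unfold retainedEdge retainedNbr
    congr 3
    exact L.comp_σ (Set.mem_singleton _) v
  have himg : Finset.univ.erase d = Finset.univ.image col := by
    ext a
    simp only [Finset.mem_erase, Finset.mem_univ, and_true, Finset.mem_image, true_and]
    exact ⟨hs a, by rintro ⟨i, rfl⟩; exact hd i⟩
  have hz0 : ∀ v ∈ R, ∑ a ∈ Finset.univ.erase d, z a v = 0 := by
    intro v hv
    rw [himg, Finset.sum_image (fun i _ j _ h => hcol h),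
      Finset.sum_congr rfl fun i _ => hz i ⟨v, hv⟩,
      ← L.sum_toricQubit hR hd (fun q => b (Sum.inl q))]
    refine Eq.trans ?_ (hb (Pi.single ⟨v, hv⟩ 1))
    rw [dotProduct, Fintype.sum_sum_type, Finset.sum_congr rfl fun s _ => hbS _ s, Finset.sum_const_zero,
      add_zero]
    refine Finset.sum_congr rfl fun q _ => ?_
    have h1 : L.unfoldMap d R col (Pi.single ⟨v, hv⟩ 1) (Sum.inl q) =
        if v ∈ q.2.1.1 then 1 else 0 := by
      rw [unfoldMap_inl]
      refine (Finset.sum_eq_single ⟨v, hv⟩ (fun u _ hu => ?_) (by simp)).trans ?_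
      · simp [hu]
      · simp
    rw [h1, mul_ite, mul_one, mul_zero]
  have hg : ∀ c : Set V, ∃ g : Color → V → ZMod 2, c ∈ L.cells d → c ⊆ R →
      (∀ k, k ≠ d → ∀ l, l ≠ d → l ≠ k → ∀ v ∈ c, g k (L.σ l v) = g k v) ∧
      ∀ a, a ≠ d → ∀ v ∈ c, z a v = ∑ k ∈ (Finset.univ.erase d).erase a, g k v := by
    intro c
    by_cases hc : c ∈ L.cells d ∧ c ⊆ R
    · obtain ⟨g, h⟩ := L.exists_face_labels hL hc.1 (z := z)
        (fun a ha v hv => hzσ a ha v (hc.2 hv)) (fun v hv => hz0 v (hc.2 hv))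
      exact ⟨g, fun _ _ => h⟩
    · exact ⟨0, fun h1 h2 => absurd ⟨h1, h2⟩ hc⟩
  choose g hg using hg
  have hg' := fun (v : V) (hv : v ∈ R) => hg (L.comp {d}ᶜ v) ⟨v, rfl⟩
    (hR.comp_subset (by simp) hv)
  have hsum : (fun q => b (Sum.inl q)) = ∑ k ∈ Finset.univ.erase d,
      fun q : L.ToricQubit R col => if col q.1 ≠ k then
        g (L.comp {d}ᶜ (L.exists_mem_toricQubit q).choose.1) k
          (L.exists_mem_toricQubit q).choose.1 else 0 := by
    ext q
    rw [Finset.sum_apply, ← Finset.sum_filter]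
    have h := (hg' _ (L.exists_mem_toricQubit q).choose.2).2 (col q.1) (hd _) _
      (L.mem_comp_self _ _)
    rw [hz, ← L.eq_retainedEdge hR hd q (L.exists_mem_toricQubit q).choose_spec] at h
    rw [h]
    refine Finset.sum_congr ?_ fun _ _ => rfl
    ext k
    simp [and_comm, eq_comm]
  rw [hsum]
  refine sum_mem fun k hk => ?_
  have hk' := Finset.ne_of_mem_erase hk
  refine L.face_labels_mem_zSpace hR hd hk'
    (g := fun v => g (L.comp {d}ᶜ v) k v) fun l hl hlk v hv => ?_
  rw [L.comp_σ (a := l) (S := {d}ᶜ) hl]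
  exact (hg' v hv).1 k hk' l hl hlk v (L.mem_comp_self _ _)

theorem zBoundaryCode_locallyEquivalent (hL : L.IsCellulation) (hR : L.IsCut d R)
    (hd : ∀ i, col i ≠ d) (hcol : Function.Injective col) (hs : ∀ a, a ≠ d → ∃ i, col i = a) :
    LocallyEquivalent (fun v : R => L.cellAround d {v.1})
      (fun q : L.ToricQubit R col => L.cellAround d q.2.1.1) (L.zBoundaryCode R)
      (CSSCode.tensor fun i : Fin 3 => L.roughToric R (col i)) := by
  have hSx : ∀ s : (Σ _ : Set V, Fin 1), (∃ v : R, L.comp {d}ᶜ v.1 = s.1) →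
      ∃ A ∈ (L.zBoundaryCode R).xs, L.unfoldMap d R col (A.indicator 1) =
        ({Sum.inr s} : Set (L.ToricQubit R col ⊕ (Σ _ : Set V, Fin 1))).indicator 1 := by
    rintro ⟨c, k⟩ ⟨v, hv⟩
    obtain rfl : L.comp {d}ᶜ v.1 = c := hv
    refine ⟨_, ⟨d, L.comp {d}ᶜ v.1, ⟨v.1, rfl⟩, Or.inl (hR.comp_subset (by simp) v.2), rfl⟩, ?_⟩
    ext (q | ⟨c', k'⟩)
    · have := congrFun (L.unfoldMap_cell_self hR hd (col := col)
        (c := L.comp {d}ᶜ v.1) ⟨v.1, rfl⟩) q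
      rw [this]
      simp
    · obtain rfl := Subsingleton.elim k k'
      rw [unfoldMap_inr]
      by_cases hc : c' = L.comp {d}ᶜ v.1
      · subst hc
        have hex : ∃ u : R, L.comp {d}ᶜ u.1 = L.comp {d}ᶜ v.1 := ⟨v, rfl⟩
        rw [dif_pos hex, indicator_val_preimage, if_pos]
        · simp
        · exact hex.choose_spec.subset (L.mem_comp_self _ _)
      · rw [Set.indicator_of_notMem (by simpa using hc)]
        split_ifs with hex
        · rw [indicator_val_preimage, if_neg]
          exact fun h => hc (hex.choose_spec.symm.trans (L.comp_eq_of_mem h))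
        · rfl
  refine locallyEquivalent_of_linearMap (fun _ => 1) (L.unfoldMap d R col)
    (L.unfoldMap_injective hR hd hs) (L.unfoldMap_local hd)
    {s | ∃ v : R, L.comp {d}ᶜ v.1 = s.1} hSx (fun s hsS x => dif_neg hsS) ?_ ?_ ?_ ?_ ?_
  · rintro _ ⟨a, c, hc, hcR, rfl⟩
    by_cases ha : a = d
    · subst ha
      exact Or.inl (L.unfoldMap_cell_self hR hd hc)
    · right
      obtain ⟨i, rfl⟩ := hs a ha
      refine ⟨_, ⟨i, _, ⟨⟨c, hc⟩, ?_, rfl⟩, rfl⟩, L.unfoldMap_cell hR hd hcol i hc⟩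
      intro e he
      obtain ⟨v, hvc, hve⟩ := Set.nonempty_of_ncard_ne_zero he
      have hvR : v ∈ R := (hcR.resolve_right fun h => h.2) hvc
      change e.1 ⊆ R
      rw [L.eq_comp_of_mem e.2 hve]
      exact hR.comp_subset (fun h => hd i h.symm) hvR
  · rintro _ ⟨i, _, ⟨⟨c, hc⟩, hcR, rfl⟩, rfl⟩
    refine ⟨_, ⟨col i, c, hc, Or.inl fun v hv => ?_, rfl⟩, L.unfoldMap_cell hR hd hcol i hc⟩
    -- Every vertex of the cell carries an edge of color `col i`, so retaining these edges retains
    -- the whole cell.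
    have h : L.comp {col i} v ⊆ R := hcR ⟨L.comp {col i} v, ⟨v, rfl⟩⟩
      (Set.ncard_ne_zero_of_mem (a := v) ⟨hv, L.mem_comp_self _ _⟩)
    exact h (L.mem_comp_self _ _)
  · rintro _ ⟨a, b, hab, f, hf, hfR, rfl⟩
    obtain ⟨x, y, hx, hyx, hcompl⟩ := exists_colors_of_face a b d hab
    obtain ⟨i, rfl⟩ := hs x hx
    have hf' : f ∈ Set.range (L.comp {col i, y}) := hcompl ▸ hf
    refine ⟨_, L.face_mem_tensor_zs hR hd hyx hf' ?_, fun x => L.unfoldMap_face hR hd i y hf' x⟩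
    rcases hfR with h | h
    · obtain ⟨v, hv⟩ := L.nonempty_of_mem_range hf
      exact ⟨v, hv, h hv⟩
    · exact h.1.1
  · rintro _ ⟨i, _, ⟨⟨⟨y, f⟩, hy, hf⟩, hfR, rfl⟩, rfl⟩
    obtain ⟨a, b, hab, hcompl⟩ := exists_compl_colors (col i) y hy
    refine ⟨_, ⟨a, b, hab, f, ?_, ?_, rfl⟩, fun x => L.unfoldMap_face hR hd i y hf x⟩
    · change f ∈ Set.range (L.comp {a, b}ᶜ)
      rw [hcompl]
      exact hf
    · obtain ⟨e, hef, heR⟩ := hfR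
      obtain ⟨v, hv⟩ := L.nonempty_of_mem_range e.2
      by_cases h : f ⊆ R
      · exact Or.inl h
      · exact Or.inr ⟨⟨⟨v, hef hv, heR hv⟩, h⟩, trivial⟩
  · intro b hb
    -- Reference bits contribute nothing: the d-cell's stabilizer maps to the bit alone, forcing its
    -- coefficient in `b` to vanish, and at the other labels the map is zero.
    refine L.mem_zSpace_of_dotProduct_unfoldMap hL hR hd hcol hs b hb fun x s => ?_
    by_cases hsS : ∃ v : R, L.comp {d}ᶜ v.1 = s.1
    · obtain ⟨A, _, hA⟩ := hSx s hsS
      have := hb (A.indicator 1)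
      rw [hA, indicator_singleton_one, dotProduct_single, mul_one] at this
      rw [this, zero_mul]
    · rw [unfoldMap_inr, dif_neg hsS, mul_zero]

end Unfolding

end ColorGraph

/-! ## Commutation of Pauli operators -/

section Commutation

variable {Q : Type*} [Fintype Q]

theorem neg_ne_self_of_isUnit [DecidableEq Q] {P : QOp Q} (h : IsUnit P) : -P ≠ P := by
  intro h'
  have h2 : (2 : ℂ) • P = 0 := by
    rw [two_smul, ← eq_neg_iff_add_eq_zero, h']
  exact h.ne_zero ((smul_eq_zero.1 h2).resolve_left two_ne_zero)

variable [inst : DecidableEq Q]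

theorem commute_iff_of_mul_eq_zmodSign_smul {P S : QOp Q} {e : ZMod 2}
    (h : P * S = zmodSign e • (S * P)) (hS : IsUnit (S * P)) : Commute P S ↔ e = 0 := by
  rcases zmod_two_cases e with rfl | rfl
  · simpa [zmodSign_zero, Commute, SemiconjBy] using h
  · rw [zmodSign_one, neg_one_smul] at h
    rw [Commute, SemiconjBy, h]
    simp [neg_ne_self_of_isUnit hS]

theorem violates_iff_of_mul_eq_zmodSign_smul {P S : QOp Q} {e : ZMod 2}
    (h : P * S = zmodSign e • (S * P)) (hS : IsUnit (S * P)) : Violates P S ↔ e = 1 := by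
  obtain rfl : inst = fun a b => Classical.propDecidable (a = b) := Subsingleton.elim _ _
  rcases zmod_two_cases e with rfl | rfl
  · rw [zmodSign_zero, one_smul] at h
    rw [Violates, h, eq_comm]
    simp [neg_ne_self_of_isUnit hS]
  · simpa [zmodSign_one, Violates] using h

theorem isUnit_xOp (A : Set Q) : IsUnit (xOp A) := by
  rw [xOp_eq_pauliX]
  exact IsUnit.of_mul_eq_one _ (pauliX_mul_self _)

theorem isUnit_zOp (A : Set Q) : IsUnit (zOp A) := by
  rw [zOp_eq_pauliZ]
  exact IsUnit.of_mul_eq_one _ (pauliZ_mul_self _)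

theorem pauli_mul_xOp (A B C : Set Q) : xOp A * zOp B * xOp C =
    zmodSign (B.indicator 1 ⬝ᵥ C.indicator 1) • (xOp C * (xOp A * zOp B)) := by
  simp only [xOp_eq_pauliX, zOp_eq_pauliZ]
  rw [mul_assoc, pauliZ_mul_pauliX, mul_smul_comm, ← mul_assoc, ← mul_assoc, ← pauliX_add,
    ← pauliX_add, add_comm]

theorem pauli_mul_zOp (A B C : Set Q) : xOp A * zOp B * zOp C =
    zmodSign (A.indicator 1 ⬝ᵥ C.indicator 1) • (zOp C * (xOp A * zOp B)) := by
  simp only [xOp_eq_pauliX, zOp_eq_pauliZ]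
  rw [← mul_assoc (pauliZ (C.indicator 1)), pauliZ_mul_pauliX, smul_mul_assoc, smul_smul,
    dotProduct_comm, zmodSign_mul_self, one_smul, mul_assoc, mul_assoc, ← pauliZ_add,
    ← pauliZ_add, add_comm]

theorem commute_xOp_iff (A B C : Set Q) : Commute (xOp A * zOp B) (xOp C) ↔
    (B.indicator 1 ⬝ᵥ C.indicator 1 : ZMod 2) = 0 :=
  commute_iff_of_mul_eq_zmodSign_smul (pauli_mul_xOp A B C)
    ((isUnit_xOp C).mul ((isUnit_xOp A).mul (isUnit_zOp B)))

theorem commute_zOp_iff (A B C : Set Q) : Commute (xOp A * zOp B) (zOp C) ↔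
    (A.indicator 1 ⬝ᵥ C.indicator 1 : ZMod 2) = 0 :=
  commute_iff_of_mul_eq_zmodSign_smul (pauli_mul_zOp A B C)
    ((isUnit_zOp C).mul ((isUnit_xOp A).mul (isUnit_zOp B)))

theorem violates_xOp_iff (A B C : Set Q) : Violates (xOp A * zOp B) (xOp C) ↔
    (B.indicator 1 ⬝ᵥ C.indicator 1 : ZMod 2) = 1 :=
  violates_iff_of_mul_eq_zmodSign_smul (pauli_mul_xOp A B C)
    ((isUnit_xOp C).mul ((isUnit_xOp A).mul (isUnit_zOp B)))

theorem violates_zOp_iff (A B C : Set Q) : Violates (xOp A * zOp B) (zOp C) ↔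
    (A.indicator 1 ⬝ᵥ C.indicator 1 : ZMod 2) = 1 :=
  violates_iff_of_mul_eq_zmodSign_smul (pauli_mul_zOp A B C)
    ((isUnit_zOp C).mul ((isUnit_xOp A).mul (isUnit_zOp B)))

end Commutation

theorem cast_ncard_eq_sum {T : Type*} [Fintype T] (s : Set T) (x : T → ZMod 2)
    (h : ∀ t, t ∈ s ↔ x t = 1) : (s.ncard : ZMod 2) = ∑ t, x t := by
  have : s = {t ∈ (Set.univ : Set T) | x t = 1} := by
    ext t
    simp [h]
  rw [this, ← indicator_dotProduct]
  simp [dotProduct]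

/-! ## Charges and fluxes -/

theorem nsmul_eq_cast_smul {M : Type*} [AddCommGroup M] [Module (ZMod 2) M] (n : ℕ) (m : M) :
    n • m = (n : ZMod 2) • m := (Nat.cast_smul_eq_nsmul (ZMod 2) n m).symm

/-- A charge of color other than `a` sees exactly two of the three fluxes, and the charge of color
`a` sees none. -/
theorem sum_xFlux (a : Color) : ∑ b ∈ Finset.univ.erase a, xFlux a b = 0 := by
  revert a
  decide

theorem sum_zCharge : ∑ a, zCharge a = 0 := by
  have h : ∑ a, zCharge a =
      Submodule.Quotient.mk (p := Submodule.span (ZMod 2) {(1 : Color → ZMod 2)})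
        (∑ a, Pi.single a ((1 : Color → ZMod 2) a)) := by
    simp only [zCharge, ← Submodule.mkQ_apply, map_sum, Pi.one_apply]
  rw [h, Submodule.Quotient.mk_eq_zero, Finset.univ_sum_single]
  exact Submodule.mem_span_singleton_self _

/-- The missing charge of color `d` is minus the sum of the other three. -/
theorem addSubgroup_eq_top_of_zCharge_mem (d : Color) (P : AddSubgroup Charge)
    (h : ∀ a, a ≠ d → zCharge a ∈ P) : P = ⊤ := by
  have hall : ∀ a, zCharge a ∈ P := by
    intro a
    by_cases ha : a = d
    · subst ha
      have h1 := sum_zCharge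
      rw [← Finset.add_sum_erase _ _ (Finset.mem_univ a)] at h1
      rw [eq_neg_of_add_eq_zero_left h1]
      exact neg_mem (sum_mem fun b hb => h b (Finset.ne_of_mem_erase hb))
    · exact h a ha
  refine (AddSubgroup.eq_top_iff' P).2 fun q => ?_
  obtain ⟨y, rfl⟩ := Submodule.Quotient.mk_surjective _ q
  have h2 : (Submodule.Quotient.mk y : Charge) = ∑ a, (y a).val • zCharge a := by
    conv_lhs => rw [← Finset.univ_sum_single y]
    simp only [zCharge, ← Submodule.mkQ_apply, map_sum, ← map_nsmul]
    refine Finset.sum_congr rfl fun a _ => congrArg _ ?_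
    rw [nsmul_eq_cast_smul, ZMod.natCast_val, ZMod.cast_id', id, ← Pi.single_smul, smul_eq_mul,
      mul_one]
  rw [h2]
  exact sum_mem fun a _ => nsmul_mem (hall a) _

/-! ### Condensation at the boundary -/

namespace ColorGraph

variable {V : Type*} [Fintype V] (L : ColorGraph V) {d : Color} {R E : Set V}

/-- Components partition the vertices, so counting by component is counting by vertex; this makes
the face count on a cell independent of the face color. -/
theorem sum_components (S : Set Color) (T : Set V → Prop) (f : V → ZMod 2) :
    ∑ s : Set V, (if s ∈ Set.range (L.comp S) ∧ T s then ∑ v, (if v ∈ s then f v else 0) else 0) =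
      ∑ v, if T (L.comp S v) then f v else 0 := by
  simp only [← Finset.sum_filter (fun s : Set V => s ∈ Set.range (L.comp S) ∧ T s)]
  rw [Finset.sum_comm]
  refine Finset.sum_congr rfl fun v _ => ?_
  by_cases hT : T (L.comp S v)
  · rw [if_pos hT, Finset.sum_eq_single (L.comp S v)]
    · exact if_pos (L.mem_comp_self S v)
    · intro s hs hne
      rw [if_neg]
      exact fun h => hne (L.eq_comp_of_mem (Finset.mem_filter.1 hs).2.1 h)
    · intro h
      exact absurd (Finset.mem_filter.2 ⟨Finset.mem_univ _, ⟨v, rfl⟩, hT⟩) h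
  · rw [if_neg hT]
    refine Finset.sum_eq_zero fun s hs => if_neg fun h => hT ?_
    obtain ⟨-, hs, hTs⟩ := Finset.mem_filter.1 hs
    rwa [L.eq_comp_of_mem hs h] at hTs

theorem dotProduct_indicator_val_preimage (A : Set R) (c : Set V) :
    (A.indicator 1 ⬝ᵥ (Subtype.val ⁻¹' c : Set R).indicator 1 : ZMod 2) =
      ∑ v, if v ∈ c then (Subtype.val '' A).indicator 1 v else 0 := by
  rw [← Finset.sum_subset (Finset.subset_univ (R.toFinset)), ← Finset.sum_set_coe, dotProduct]
  · refine Finset.sum_congr rfl fun v _ => ?_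
    simp only [Set.indicator, Set.mem_preimage, Pi.one_apply, Set.mem_image, Subtype.exists,
      exists_and_right, exists_eq_right, Subtype.coe_eta, Subtype.coe_prop, exists_const]
    split_ifs <;> simp
  · intro v _ hv
    rw [Set.indicator_of_notMem, ite_self]
    rintro ⟨u, _, rfl⟩
    exact hv (Set.mem_toFinset.2 u.2)

/-- No flux can run into a patch of the boundary on which no face is violated. -/
theorem fluxInto_eq_zero (A B : Set R)
    (h : ∀ a b, a ≠ b → ∀ f ∈ L.faces a b, IsTruncated R f →
      Commute (xOp A * zOp B) (zOp (Subtype.val ⁻¹' f))) :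
    L.fluxInto R E (xOp A * zOp B) = 0 := by
  refine Finset.sum_eq_zero fun a _ => ?_
  let α : V → ZMod 2 := (Subtype.val '' A).indicator 1
  -- The right side does not mention `b`, so it factors out of the sum of fluxes.
  have hcount : ∀ b ∈ Finset.univ.erase a,
      ({f ∈ L.faces a b | f ⊆ R ∧ Violates (xOp A * zOp B) (zOp (Subtype.val ⁻¹' f)) ∧
        ∃ c ∈ L.patchCells R E a, f ⊆ c}.ncard : ZMod 2) =
      ∑ v, if ∃ c ∈ L.patchCells R E a, v ∈ c then α v else 0 := by
    intro b hb
    obtain ⟨T, hT⟩ : ∃ T : Set V → Prop, ∀ f, (∃ c ∈ L.patchCells R E a, f ⊆ c) ↔ T f :=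
      ⟨_, fun _ => Iff.rfl⟩
    simp only [hT]
    rw [cast_ncard_eq_sum _ (fun f => if f ∈ Set.range (L.comp {a, b}ᶜ) ∧ T f then
        ∑ v, (if v ∈ f then α v else 0) else 0), L.sum_components]
    · simp only [← hT]
      refine Finset.sum_congr rfl fun v _ => if_congr ?_ rfl rfl
      constructor
      · rintro ⟨c, hc, hv⟩
        exact ⟨c, hc, hv (L.mem_comp_self _ _)⟩
      · rintro ⟨c, hc, hv⟩
        refine ⟨c, hc, ?_⟩
        rw [L.eq_comp_of_mem hc.1 hv]
        exact L.comp_mono (Set.compl_subset_compl.2 (by simp)) _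
    · intro f
      constructor
      · rintro ⟨hf, hfR, hviol, hc⟩
        rw [if_pos ⟨hf, hc⟩, ← dotProduct_indicator_val_preimage]
        exact (violates_zOp_iff _ _ _).1 hviol
      · intro hf
        have hcond : f ∈ Set.range (L.comp {a, b}ᶜ) ∧ T f := by
          by_contra hn
          rw [if_neg hn] at hf
          exact zero_ne_one hf
        rw [if_pos hcond, ← dotProduct_indicator_val_preimage] at hf
        refine ⟨hcond.1, ?_, (violates_zOp_iff _ _ _).2 hf, hcond.2⟩
        -- Faces not inside `R` have even parity, by commutation if truncated and trivially if
        -- disjoint from `R`, so the sum may run over all faces.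
        by_contra hfR
        have hne : (f ∩ R).Nonempty := by
          by_contra hemp
          have : (Subtype.val ⁻¹' f : Set R) = ∅ := by
            ext v
            simp only [Set.mem_preimage, Set.mem_empty_iff_false, iff_false]
            exact fun hv => hemp ⟨v.1, hv, v.2⟩
          rw [this] at hf
          simp at hf
        have := (commute_zOp_iff A B _).1
          (h a b (Finset.ne_of_mem_erase hb).symm f hcond.1 ⟨hne, hfR⟩)
        rw [this] at hf
        exact zero_ne_one hf
  simp only [nsmul_eq_cast_smul]
  rw [Finset.sum_congr rfl fun b hb => by rw [hcount b hb], ← Finset.smul_sum, sum_xFlux,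
    smul_zero]

variable (R)

/-- The charge in the bulk that is created by `Z` operators with the given support vector. -/
def chargeMap : (R → ZMod 2) →+ Charge where
  toFun β := ∑ a, (∑ c : Set V, if c ∈ L.cells a ∧ c ⊆ R then
    β ⬝ᵥ (Subtype.val ⁻¹' c : Set R).indicator 1 else 0) • zCharge a
  map_zero' := by simp
  map_add' x y := by
    rw [← Finset.sum_add_distrib]
    refine Finset.sum_congr rfl fun a _ => ?_
    rw [← add_smul, ← Finset.sum_add_distrib]
    congr 1
    refine Finset.sum_congr rfl fun c _ => ?_
    split_ifs
    · rw [add_dotProduct]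
    · rw [add_zero]

variable {R}

theorem bulkCharge_eq (A B : Set R) :
    L.bulkCharge R (xOp A * zOp B) = L.chargeMap R (B.indicator 1) := by
  refine Finset.sum_congr rfl fun a _ => ?_
  rw [nsmul_eq_cast_smul]
  congr 1
  refine cast_ncard_eq_sum _ _ fun c => ?_
  rw [Set.mem_ofPred_eq, violates_xOp_iff, ← and_assoc]
  split_ifs with hc
  · simp [hc]
  · simp [hc]

/-- Put `Z` on both ends of each a-edge of the path. A cell of another color contains both ends or
neither, a step along another color stays in the same a-cell, and intermediate a-cells cancel,
leaving only those at `v` and `w`. -/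
theorem exists_string (a : Color) {v w : V}
    (h : Relation.ReflTransGen (fun u u' => u' ∈ R ∧ ∃ b, u' = L.σ b u) v w) (hv : v ∈ R) :
    w ∈ R ∧ ∃ β : R → ZMod 2, ∀ a', ∀ c ∈ L.cells a',
      β ⬝ᵥ (Subtype.val ⁻¹' c : Set R).indicator 1 =
        if a' = a then (if v ∈ c then 1 else 0) + (if w ∈ c then 1 else 0) else 0 := by
  have hσ : ∀ {a' : Color} {c : Set V} (_ : c ∈ L.cells a') {b : Color} (_ : b ≠ a') (u : V),
      L.σ b u ∈ c ↔ u ∈ c := by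
    intro a' c hc b hb u
    refine ⟨fun h => ?_, fun h => L.σ_mem_of_mem_range hc hb h⟩
    have := L.σ_mem_of_mem_range hc hb h
    rwa [L.σ_σ] at this
  induction h with
  | refl =>
    refine ⟨hv, 0, fun a' c _ => ?_⟩
    simp [CharTwo.add_self_eq_zero]
  | @tail u u' _ hu ih =>
    obtain ⟨huR, β, hβ⟩ := ih
    obtain ⟨hu'R, b, rfl⟩ := hu
    refine ⟨hu'R, ?_⟩
    by_cases hb : b = a
    · subst hb
      refine ⟨β + Pi.single ⟨u, huR⟩ 1 + Pi.single ⟨L.σ b u, hu'R⟩ 1, fun a' c hc => ?_⟩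
      rw [add_dotProduct, add_dotProduct, single_dotProduct, single_dotProduct, hβ a' c hc,
        indicator_val_preimage, indicator_val_preimage, one_mul, one_mul]
      by_cases ha : a' = b
      · rw [if_pos ha, if_pos ha, add_assoc (if v ∈ c then (1 : ZMod 2) else 0),
          CharTwo.add_self_eq_zero, add_zero]
      · rw [if_neg ha, if_neg ha, if_congr (hσ hc (Ne.symm ha) u) rfl rfl, zero_add,
          CharTwo.add_self_eq_zero]
    · refine ⟨β, fun a' c hc => ?_⟩
      rw [hβ a' c hc]
      by_cases ha : a' = a
      · subst ha
        rw [if_congr (hσ hc hb u) rfl rfl]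
      · rw [if_neg ha, if_neg ha]

/-- The admissible `Z`-supports form a group, so realizing the charge of each color other than `d`
is enough. A string that starts in `E` violates one truncated cell of the patch, where this is
permitted, and one bulk cell. -/
theorem exists_charge (hE : ∀ v ∈ E, v ∈ R ∧ L.σ d v ∉ R)
    (hadj : L.AdjacentToBulk d R E) (q : Charge) :
    ∃ β : R → ZMod 2, (∀ a, ∀ c ∈ L.cells a, IsTruncated R c → c ∉ L.patchCells R E a →
      β ⬝ᵥ (Subtype.val ⁻¹' c : Set R).indicator 1 = 0) ∧ L.chargeMap R β = q := by
  let W : AddSubgroup (R → ZMod 2) :=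
    { carrier := {β | ∀ a, ∀ c ∈ L.cells a, IsTruncated R c → c ∉ L.patchCells R E a →
        β ⬝ᵥ (Subtype.val ⁻¹' c : Set R).indicator 1 = 0}
      zero_mem' := fun a c _ _ _ => zero_dotProduct _
      add_mem' := fun {x y} hx hy a c h1 h2 h3 => by
        rw [add_dotProduct, hx a c h1 h2 h3, hy a c h1 h2 h3, add_zero]
      neg_mem' := fun {x} hx a c h1 h2 h3 => by
        rw [neg_dotProduct, hx a c h1 h2 h3, neg_zero] }
  have htop := addSubgroup_eq_top_of_zCharge_mem d (W.map (L.chargeMap R)) fun a ha => by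
    obtain ⟨v, hvE, w, hw, hpath⟩ := hadj a ha
    obtain ⟨-, β, hβ⟩ := L.exists_string a hpath (hE v hvE).1
    refine ⟨β, fun a' c hc htr hpatch => ?_, ?_⟩
    · rw [hβ a' c hc]
      by_cases ha' : a' = a
      · subst ha'
        rw [if_pos rfl, if_neg, if_neg, add_zero]
        · exact fun h => htr.2 (L.eq_comp_of_mem hc h ▸ hw)
        · exact fun h => hpatch ⟨hc, htr, v, h, hvE⟩
      · exact if_neg ha'
    · change ∑ a, (∑ c : Set V, if c ∈ L.cells a ∧ c ⊆ R then
        β ⬝ᵥ (Subtype.val ⁻¹' c : Set R).indicator 1 else 0) • zCharge a = zCharge a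
      refine (Finset.sum_eq_single a (fun a' _ ha' => ?_)
        (fun h => absurd (Finset.mem_univ _) h)).trans ?_
      · rw [Finset.sum_eq_zero, zero_smul]
        intro c _
        split_ifs with hc
        · rw [hβ a' c hc.1, if_neg ha']
        · rfl
      · rw [Finset.sum_eq_single (L.comp {a}ᶜ w), if_pos ⟨⟨w, rfl⟩, hw⟩, hβ a _ ⟨w, rfl⟩,
          if_pos rfl, if_neg, if_pos (L.mem_comp_self _ _), zero_add, one_smul]
        -- The a-cell at `v` contains the lost end of the cut edge, so it differs from the retained
        -- cell at `w`.
        · exact fun h => (hE v hvE).2 (hw (L.σ_mem_of_mem_range (S := {a}ᶜ) ⟨w, rfl⟩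
            (Ne.symm ha) h))
        · intro c _ hne
          split_ifs with hc
          · rw [hβ a c hc.1, if_pos rfl, if_neg, if_neg, add_zero]
            · exact fun h => hne (L.eq_comp_of_mem hc.1 h)
            · exact fun h => (hE v hvE).2 (hc.2 (L.σ_mem_of_mem_range hc.1 (Ne.symm ha) h))
          · rfl
        · simp
  have hq : q ∈ W.map (L.chargeMap R) := htop ▸ AddSubgroup.mem_top q
  obtain ⟨β, hβ, rfl⟩ := hq
  exact ⟨β, hβ, rfl⟩

theorem condenses_iff (hE : ∀ v ∈ E, v ∈ R ∧ L.σ d v ∉ R)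
    (hadj : L.AdjacentToBulk d R E) (x : Excitation) :
    L.Condenses R False True E x ↔ x.2 = 0 := by
  constructor
  · rintro ⟨A, B, -, h, -, hflux⟩
    rw [L.fluxInto_eq_zero A B fun a b hab f hf ht => h a b hab f hf ht trivial] at hflux
    exact Subtype.ext hflux.symm
  · intro hx
    obtain ⟨β, hβ, hq⟩ := L.exists_charge hE hadj x.1
    have hind : ({v | β v = 1} : Set R).indicator 1 = β := by
      ext v
      rcases zmod_two_cases (β v) with h | h <;> simp [Set.indicator, h]
    have hz : ∀ a b, a ≠ b → ∀ f ∈ L.faces a b, IsTruncated R f →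
        Commute (xOp (∅ : Set R) * zOp {v | β v = 1}) (zOp (Subtype.val ⁻¹' f)) :=
      fun a b _ f _ _ => (commute_zOp_iff _ _ _).2 (by simp)
    -- A pure `Z`-operator commutes with every face stabilizer, so it realizes the charge with no
    -- flux.
    refine ⟨∅, {v | β v = 1}, fun a c hc htr hp => ?_, fun a b hab f hf ht _ => hz a b hab f hf ht,
      ?_, ?_⟩
    · rw [commute_xOp_iff, hind]
      exact hβ a c hc htr (hp.resolve_left id)
    · rw [bulkCharge_eq, hind, hq]
    · rw [L.fluxInto_eq_zero _ _ hz, hx]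
      rfl

end ColorGraph

theorem closure_zCharge (c₁ c₂ c₃ c₄ : Color) (hs : ∀ a, a ≠ c₄ → a = c₁ ∨ a = c₂ ∨ a = c₃)
    (x : Excitation) :
    x ∈ AddSubgroup.closure {((zCharge c₁, 0) : Excitation), (zCharge c₂, 0), (zCharge c₃, 0)} ↔
      x.2 = 0 := by
  constructor
  · intro hx
    have hle : AddSubgroup.closure
        {((zCharge c₁, 0) : Excitation), (zCharge c₂, 0), (zCharge c₃, 0)} ≤
        (AddMonoidHom.snd Charge Flux).ker := by
      rw [AddSubgroup.closure_le]
      rintro _ (rfl | rfl | rfl) <;> rfl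
    exact hle hx
  · intro hx
    have htop := addSubgroup_eq_top_of_zCharge_mem c₄ ((AddSubgroup.closure
      {((zCharge c₁, 0) : Excitation), (zCharge c₂, 0), (zCharge c₃, 0)}).comap
        (AddMonoidHom.inl Charge Flux)) fun a ha => by
      refine AddSubgroup.subset_closure ?_
      rcases hs a ha with rfl | rfl | rfl
      · exact Or.inl rfl
      · exact Or.inr (Or.inl rfl)
      · exact Or.inr (Or.inr rfl)
    have h : x.1 ∈ _ := htop ▸ AddSubgroup.mem_top x.1
    obtain ⟨q, φ⟩ := x
    obtain rfl : φ = 0 := hx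
    exact h

end

theorem mainTheorem1 {V : Type*} [Fintype V] (L : ColorGraph V) (hL : L.IsCellulation)
    (c₁ c₂ c₃ c₄ : Color) (hc : [c₁, c₂, c₃, c₄].Nodup) (R : Set V) (hR : L.IsCut c₄ R) :
    (∀ E : Set V, (∀ v ∈ E, v ∈ R ∧ L.σ c₄ v ∉ R) → L.AdjacentToBulk c₄ R E →
      {x | L.Condenses R False True E x} =
        AddSubgroup.closure {((zCharge c₁, 0) : Excitation), (zCharge c₂, 0), (zCharge c₃, 0)}) ∧
    LocallyEquivalent
      (fun v : R => L.cellAround c₄ {v.1})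
      (fun q : (Σ i : Fin 3, L.retained R (![c₁, c₂, c₃] i)) => L.cellAround c₄ q.2.1.1)
      (L.zBoundaryCode R)
      (CSSCode.tensor fun i : Fin 3 => L.roughToric R (![c₁, c₂, c₃] i)) := by
  have hcolors : ∀ c₁ c₂ c₃ c₄ : Color, [c₁, c₂, c₃, c₄].Nodup →
      (∀ i, ![c₁, c₂, c₃] i ≠ c₄) ∧
      (∀ i j, ![c₁, c₂, c₃] i = ![c₁, c₂, c₃] j → i = j) ∧
      (∀ a, a ≠ c₄ → ∃ i, ![c₁, c₂, c₃] i = a) ∧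
      ∀ a, a ≠ c₄ → a = c₁ ∨ a = c₂ ∨ a = c₃ := by decide
  obtain ⟨hd, hcol, hs, hs'⟩ := hcolors c₁ c₂ c₃ c₄ hc
  refine ⟨fun E hE hadj => Set.ext fun x => ?_,
    L.zBoundaryCode_locallyEquivalent hL hR hd (fun i j => hcol i j) hs⟩
  exact (L.condenses_iff hE hadj x).trans (closure_zCharge c₁ c₂ c₃ c₄ hs' x).symm
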